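/- Let $A\in\mathbb R^{n\times n}$, $0\ne B\in\mathbb R^{n\times m}$, $K\in\mathbb R^{m\times n}$, let $P,Q\in\mathbb R^{n\times n}$ be symmetric positive definite with $(A+BK)^{\top}P+P(A+BK)=-Q$, and let $\theta\in(0,1)$. Write $|\cdot|$ for the Euclidean norm of vectors and the induced norm of matrices, and $\lambda_{\min},\lambda_{\max}$ for the smallest and largest eigenvalue. Let $\phi:[0,\infty)\to\mathbb R$ be continuously differentiable with $0<t-\phi(t)\le M_0$ and $m_2\le\dot\phi(t)\le M_1$ for all $t\ge0$ and some constants $M_0,m_2,M_1>0$, and let $\sigma=\phi^{-1}:[\phi(0),\infty)\to[0,\infty)$. Consider the plant $$\dot x(t)=Ax(t)+Bu(\phi(t)),\qquad t\ge0,$$ with arbitrary $x(0)\in\mathbb R^n$ and arbitrary bounded measurable initial input $u$ on $[\phi(0),0)$ (solutions being understood in the integrated sense), and the predictor $$p(t)=e^{A(\sigma(t)-t^+)}x(t^+)+\int_{\phi(t^+)}^{t}\dot\sigma(s)\,e^{A(\sigma(t)-\sigma(s))}Bu(s)\,ds,\qquad t^+=\max\{t,0\},\ t\ge\phi(0).$$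 Let the input be $u(t)=Kp(t_k)$ for $t\in[t_k,t_{k+1})$, $k\ge0$, where $t_0=0$ and $t_{k+1}$ is the first time $t>t_k$ with $p(t)\neq0$ at which the triggering condition $$|e(t)|\le\frac{\lambda_{\min}(Q)\sqrt\theta}{4|PB||K|}\,|p(t)|,\qquad e(t)=p(t_k)-p(t),$$ is reached with equality (the inequality being read as $4|PB||K||e(t)|\le\lambda_{\min}(Q)\sqrt\theta\,|p(t)|$), with $t_{k+1}=\infty$ and no further events if there is no such time. Then there is a constant $C>0$, depending only on $A,B,K,P,Q,\theta,\phi$ and not on the initial data, such that every such closed-loop trajectory satisfies, with $|u|^2$ integrable on $[\phi(t),t]$, $$|x(t)|^2+\int_{\phi(t)}^{t}|u(\tau)|^2\,d\tau\le C\,e^{-\mu t}\Big(|x(0)|^2+\int_{\phi(0)}^{0}|u(\tau)|^2\,d\tau\Big)\quad\text{for all }t\ge0,\qquad \mu=\frac{(2-\theta)\lambda_{\min}(Q)}{4\lambda_{\max}(P)}.$$ -/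

import Mathlib

open Set MeasureTheory

noncomputable section

namespace EventTrigger

/-- The Euclidean (column vector) space `ℝⁿ`. -/
abbrev Vec (n : ℕ) : Type := EuclideanSpace ℝ (Fin n)

/-- The action of a real matrix on Euclidean column vectors. -/
abbrev act {k l : ℕ} (M : Matrix (Fin k) (Fin l) ℝ) (v : Vec l) : Vec k :=
  Matrix.toEuclideanLin M v

/-- The matrix norm induced by the Euclidean norms. -/
def inducedNorm {k l : ℕ} (M : Matrix (Fin k) (Fin l) ℝ) : ℝ :=
  ‖LinearMap.toContinuousLinearMap (Matrix.toEuclideanLin M)‖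

/-- The smallest eigenvalue of a (symmetric) real matrix. -/
def lambdaMin {n : ℕ} (M : Matrix (Fin n) (Fin n) ℝ) : ℝ := sInf (spectrum ℝ M)

/-- The largest eigenvalue of a (symmetric) real matrix. -/
def lambdaMax {n : ℕ} (M : Matrix (Fin n) (Fin n) ℝ) : ℝ := sSup (spectrum ℝ M)

/-- The standing assumptions on the delayed time `φ : [0, ∞) → ℝ` (only the values on `[0, ∞)`
are used): it is continuously differentiable, the delay `t - φ t` is positive and bounded, and
the derivative of `φ` is bounded and bounded away from zero. -/
structure AdmissibleDelay (φ : ℝ → ℝ) : Prop where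
  contDiffOn : ContDiffOn ℝ 1 φ (Ici 0)
  delay_pos : ∀ t : ℝ, 0 ≤ t → 0 < t - φ t
  delay_bdd : ∃ M₀ : ℝ, 0 < M₀ ∧ ∀ t : ℝ, 0 ≤ t → t - φ t ≤ M₀
  deriv_bdd : ∃ m₂ M₁ : ℝ, 0 < m₂ ∧ 0 < M₁ ∧
    ∀ t : ℝ, 0 ≤ t → m₂ ≤ derivWithin φ (Ici 0) t ∧ derivWithin φ (Ici 0) t ≤ M₁

/-- The inverse `σ = φ⁻¹ : [φ 0, ∞) → [0, ∞)`. -/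
def advance (φ : ℝ → ℝ) : ℝ → ℝ := Function.invFunOn φ (Ici 0)

/-- The explicit linear predictor
`p t = e^{A (σ t - t⁺)} x(t⁺) + ∫_{φ(t⁺)}^t σ'(s) e^{A (σ t - σ s)} B u(s) ds`, `t ≥ φ 0`,
where `t⁺ = max t 0`. -/
def predictor {n m : ℕ} (A : Matrix (Fin n) (Fin n) ℝ) (B : Matrix (Fin n) (Fin m) ℝ)
    (φ : ℝ → ℝ) (x : ℝ → Vec n) (u : ℝ → Vec m) (t : ℝ) : Vec n :=
  act (NormedSpace.exp ((advance φ t - max t 0) • A)) (x (max t 0)) +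
    ∫ s in (φ (max t 0))..t,
      derivWithin (advance φ) (Ici (φ 0)) s •
        act (NormedSpace.exp ((advance φ t - advance φ s) • A)) (act B (u s))

/-- `x` solves `x' = A x + B u(φ)` on `[0, ∞)` in the Carathéodory (integrated) sense. -/
def IsPlantSolution {n m : ℕ} (A : Matrix (Fin n) (Fin n) ℝ) (B : Matrix (Fin n) (Fin m) ℝ)
    (φ : ℝ → ℝ) (x : ℝ → Vec n) (u : ℝ → Vec m) : Prop :=
  ∀ t : ℝ, 0 ≤ t →
    IntervalIntegrable (fun s => act A (x s) + act B (u (φ s))) volume 0 t ∧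
    x t = x 0 + ∫ s in (0 : ℝ)..t, (act A (x s) + act B (u (φ s)))

/-- The times after the update time `τ` at which the trigger
`|e| ≤ λ_min(Q) √θ / (4 |P B| |K|) · |p|`, with `e(t) = p(τ) - p(t)`, is reached with equality
at a nonzero prediction. The denominator is cleared; where `p` vanishes together with `e`, the
trigger holds and there is nothing to update. -/
def triggerSet {n m : ℕ} (B : Matrix (Fin n) (Fin m) ℝ) (K : Matrix (Fin m) (Fin n) ℝ)
    (P Q : Matrix (Fin n) (Fin n) ℝ) (θ : ℝ) (p : ℝ → Vec n) (τ : ℝ) : Set ℝ :=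
  {t | τ < t ∧ p t ≠ 0 ∧
    4 * inducedNorm (P * B) * inducedNorm K * ‖p τ - p t‖ = lambdaMin Q * √θ * ‖p t‖}

/-- `T` is the sequence of event times generated from the prediction `p`: `T 0 = 0`, and
`T (k + 1)` is the first trigger time after `T k`; the value `⊤` means that there is no further
event. -/
structure IsEventSequence {n m : ℕ} (B : Matrix (Fin n) (Fin m) ℝ) (K : Matrix (Fin m) (Fin n) ℝ)
    (P Q : Matrix (Fin n) (Fin n) ℝ) (θ : ℝ) (p : ℝ → Vec n) (T : ℕ → WithTop ℝ) : Prop where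
  zero : T 0 = ((0 : ℝ) : WithTop ℝ)
  succ : ∀ (k : ℕ) (τ : ℝ), T k = (τ : WithTop ℝ) →
    IsLeast (insert ⊤ ((fun t : ℝ => (t : WithTop ℝ)) '' triggerSet B K P Q θ p τ)) (T (k + 1))
  succ_top : ∀ k : ℕ, T k = ⊤ → T (k + 1) = ⊤

/-- `x`, `u`, `T` are the state, the input and the event times of the event-triggered closed loop.
The input on `[φ 0, 0)` is arbitrary (bounded, measurable) initial data; from time `0` on it is
held constant between events. -/
structure IsClosedLoop {n m : ℕ} (A : Matrix (Fin n) (Fin n) ℝ) (B : Matrix (Fin n) (Fin m) ℝ)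
    (K : Matrix (Fin m) (Fin n) ℝ) (P Q : Matrix (Fin n) (Fin n) ℝ) (θ : ℝ) (φ : ℝ → ℝ)
    (x : ℝ → Vec n) (u : ℝ → Vec m) (T : ℕ → WithTop ℝ) : Prop where
  init_meas : AEStronglyMeasurable u (volume.restrict (Ico (φ 0) 0))
  init_bdd : ∃ M : ℝ, ∀ s ∈ Ico (φ 0) 0, ‖u s‖ ≤ M
  plant : IsPlantSolution A B φ x u
  events : IsEventSequence B K P Q θ (predictor A B φ x u) T
  control : ∀ (k : ℕ) (τ : ℝ), T k = (τ : WithTop ℝ) →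
    ∀ t : ℝ, τ ≤ t → (t : WithTop ℝ) < T (k + 1) → u t = act K (predictor A B φ x u τ)

end EventTrigger

end

/-!
The predictor is the future state: the variation of constants formula on `[t, σ t]` and the
substitution `r = σ s` give `p t = x (σ t)` for `t ≥ 0` (`predictor_eq`). So, in the time variable
`r = σ t`, the delay disappears: between the images of two consecutive events the state solves
`x' = A x + B K x(r_k)`, a sampled version of the stable system `x' = (A + B K) x`.

*Decay.* Along such a piece the derivative of `V = ⟪x, P x⟫` is
`-⟪x, Q x⟫ + 2 ⟪P x, B K (x(r_k) - x)⟫`, and the trigger bounds the second term by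
`√θ / 2 * λ_min(Q) * |x|²`. Hence `V' ≤ -(1 - √θ / 2) λ_min(Q) / λ_max(P) * V`, which is at least as
fast as the rate `μ` in the statement because `θ - 2 √θ + 2 = (√θ - 1) ^ 2 + 1 ≥ 0`
(`lyapunov_decay`).

*Events do not accumulate.* By Gronwall, `|x(r) - x(r_k)| ≤ |x(r_k)| η(r - r_k)` with a function `η`
that depends on `A`, `B`, `K` only and vanishes at `0`, whereas at an event this quantity is a fixed
fraction of `|x(r)| ≠ 0`. This bounds `r_{k+1} - r_k` below (`exists_dwell_time`), so that the event
intervals cover `[0, ∞)` (`IsClosedLoop.exists_event_le`). The same bound shows that `p` vanishes on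
the whole event interval once it vanishes at its start, and then the intermediate value theorem
gives the trigger inequality between events (`IsClosedLoop.trigger_le`).

*Conclusion.* On `[0, σ 0]` the state is driven by the initial input and is bounded by the initial
data (`exists_initial_bound`); after `σ 0` it decays with `V` (`exists_state_bound`). The trigger also
bounds `|u t|` by a multiple of `|p t| = |x (σ t)|`, and `σ τ ≥ t` for `τ ≥ φ t`, so that the integral of
`|u|²` over the part of `[φ t, t]` after time `0` has the same decay; the part before time `0` is only
present while `t ≤ σ 0`.
-/

namespace EventTrigger

/-! ### Linear equations with integrable forcing -/

theorem continuousOn_of_integral_equation {E : Type*} [NormedAddCommGroup E]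
    [NormedSpace ℝ E] {x f : ℝ → E}
    (hx : ∀ t, 0 ≤ t → IntervalIntegrable f volume 0 t ∧ x t = x 0 + ∫ s in (0 : ℝ)..t, f s) :
    ContinuousOn x (Ici 0) := by
  intro t ht
  have h0 : (0 : ℝ) ≤ t + 1 := by linarith [mem_Ici.1 ht]
  have hc : ContinuousOn (fun t => x 0 + ∫ s in (0 : ℝ)..t, f s) (Icc 0 (t + 1)) := by
    refine continuousOn_const.add ?_
    have := (hx _ h0).1
    rw [intervalIntegrable_iff_integrableOn_Icc_of_le h0] at this
    rw [← uIcc_of_le h0] at this ⊢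
    exact intervalIntegral.continuousOn_primitive_interval this
  have h1 : ContinuousOn x (Icc 0 (t + 1)) := hc.congr fun s hs => (hx s hs.1).2
  refine (h1 t ⟨ht, by linarith⟩).mono_of_mem_nhdsWithin ?_
  rw [← Ici_inter_Iic]
  exact inter_mem_nhdsWithin _ (Iic_mem_nhds (by linarith))

section VariationOfConstants

variable {E : Type*} [NormedAddCommGroup E] [NormedSpace ℝ E] [CompleteSpace E]

/-- Integration by parts of `Φ` against the primitive of a merely integrable `g`. The primitive need
not be differentiable everywhere, so the formula is obtained from Fubini's theorem on the triangle
`q ≤ r`. -/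
theorem integral_deriv_apply_primitive {Φ Φ' : ℝ → E →L[ℝ] E}
    (hΦ : ∀ r, HasDerivAt Φ (Φ' r) r) (hΦ' : Continuous Φ') {g : ℝ → E} {a b : ℝ} (hab : a ≤ b)
    (hg : IntervalIntegrable g volume a b) :
    ∫ r in a..b, Φ' r (∫ q in a..r, g q) =
      Φ b (∫ q in a..b, g q) - ∫ q in a..b, Φ q (g q) := by
  have hΦc : Continuous Φ := continuous_iff_continuousAt.2 fun r => (hΦ r).continuousAt
  have hgi : IntegrableOn g (Ioc a b) := (intervalIntegrable_iff_integrableOn_Ioc_of_le hab).1 hg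
  set S : Set (ℝ × ℝ) := {p | p.2 ≤ p.1} with hS
  have hSm : MeasurableSet S := measurableSet_le measurable_snd measurable_fst
  set F : ℝ → ℝ → E := fun r q => S.indicator (fun p => Φ' p.1 (g p.2)) (r, q) with hF
  have hint : Integrable (Function.uncurry F)
      ((volume.restrict (Ioc a b)).prod (volume.restrict (Ioc a b))) := by
    have h1 : Integrable (fun p : ℝ × ℝ => ‖Φ' p.1‖ * ‖g p.2‖)
        ((volume.restrict (Ioc a b)).prod (volume.restrict (Ioc a b))) :=
      Integrable.mul_prod (f := fun r => ‖Φ' r‖) (g := fun q => ‖g q‖)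
        ((hΦ'.norm.integrableOn_Icc (a := a) (b := b)).mono_set Ioc_subset_Icc_self) hgi.norm
    have h2 : Integrable (fun p : ℝ × ℝ => Φ' p.1 (g p.2))
        ((volume.restrict (Ioc a b)).prod (volume.restrict (Ioc a b))) := by
      refine h1.mono' ?_ (Filter.Eventually.of_forall fun p => (Φ' p.1).le_opNorm _)
      have hm : AEStronglyMeasurable (fun p : ℝ × ℝ => Φ' p.1)
          ((volume.restrict (Ioc a b)).prod (volume.restrict (Ioc a b))) :=
        (hΦ'.comp continuous_fst).aestronglyMeasurable
      exact (ContinuousLinearMap.id ℝ (E →L[ℝ] E)).aestronglyMeasurable_comp₂ hm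
        hgi.aestronglyMeasurable.comp_snd
    exact h2.indicator hSm
  have hL : ∫ r in a..b, Φ' r (∫ q in a..r, g q) = ∫ r in Ioc a b, ∫ q in Ioc a b, F r q := by
    rw [intervalIntegral.integral_of_le hab]
    refine setIntegral_congr_fun measurableSet_Ioc fun r hr => ?_
    have hgr : IntegrableOn g (Ioc a r) := hgi.mono_set (Ioc_subset_Ioc_right hr.2)
    have hFr : ∀ q, F r q = (Iic r).indicator (fun q => Φ' r (g q)) q := fun q => by
      simp [hF, hS, Set.indicator_apply]
    simp only [hFr]
    rw [setIntegral_indicator measurableSet_Iic, Ioc_inter_Iic, min_eq_right hr.2,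
      intervalIntegral.integral_of_le hr.1.le, (Φ' r).integral_comp_comm hgr]
  have hR : ∫ q in Ioc a b, ∫ r in Ioc a b, F r q = ∫ q in Ioc a b, (Φ b (g q) - Φ q (g q)) := by
    refine setIntegral_congr_fun measurableSet_Ioc fun q hq => ?_
    have hFq : ∀ r, F r q = (Ici q).indicator (fun r => Φ' r (g q)) r := fun r => by
      simp [hF, hS, Set.indicator_apply]
    simp only [hFq]
    rw [setIntegral_indicator measurableSet_Ici]
    have hset : Ioc a b ∩ Ici q = Icc q b := by
      ext r; simp only [mem_inter_iff, mem_Ioc, mem_Ici, mem_Icc]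
      constructor
      · rintro ⟨⟨_, h⟩, h'⟩; exact ⟨h', h⟩
      · rintro ⟨h, h'⟩; exact ⟨⟨hq.1.trans_le h, h'⟩, h⟩
    rw [hset, integral_Icc_eq_integral_Ioc, ← intervalIntegral.integral_of_le hq.2]
    exact intervalIntegral.integral_eq_sub_of_hasDerivAt
      (f := fun r => Φ r (g q)) (fun r _ => by simpa using (hΦ r).clm_apply (hasDerivAt_const r (g q)))
      ((hΦ'.clm_apply continuous_const).intervalIntegrable _ _)
  have hbi : IntegrableOn (fun q => Φ b (g q)) (Ioc a b) := (Φ b).integrable_comp hgi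
  have hqi : IntegrableOn (fun q => Φ q (g q)) (Ioc a b) := by
    have hbd : ∃ M, ∀ q ∈ Icc a b, ‖Φ q‖ ≤ M :=
      isCompact_Icc.exists_bound_of_continuousOn hΦc.continuousOn
    obtain ⟨M, hM⟩ := hbd
    refine (hgi.norm.const_mul M).mono' ((ContinuousLinearMap.id ℝ
      (E →L[ℝ] E)).aestronglyMeasurable_comp₂ hΦc.aestronglyMeasurable
        hgi.aestronglyMeasurable) ?_
    refine (ae_restrict_mem measurableSet_Ioc).mono fun q hq => ?_
    exact (Φ q).le_of_opNorm_le (hM q (Ioc_subset_Icc_self hq)) _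
  rw [hL, integral_integral_swap hint, hR, integral_sub hbi hqi, intervalIntegral.integral_of_le hab,
    intervalIntegral.integral_of_le hab, (Φ b).integral_comp_comm hgi]

variable {L : E →L[ℝ] E} {x g : ℝ → E}

theorem hasDerivAt_exp_sub_smul (L : E →L[ℝ] E) (t r : ℝ) :
    HasDerivAt (fun r : ℝ => NormedSpace.exp ((t - r) • L))
      (-(NormedSpace.exp ((t - r) • L) * L)) r := by
  have h := (hasDerivAt_exp_smul_const (𝕂 := ℝ) L (t - r)).scomp r ((hasDerivAt_id r).const_sub t)
  simpa using! h

/-- The variation of constants formula for solutions, in the integrated sense, of `x' = L x + g` with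
`g` locally integrable. -/
theorem variation_of_constants
    (hx : ∀ t, 0 ≤ t → IntervalIntegrable (fun s => L (x s) + g s) volume 0 t ∧
      x t = x 0 + ∫ s in (0 : ℝ)..t, (L (x s) + g s)) {s t : ℝ} (hs : 0 ≤ s) (hst : s ≤ t) :
    IntervalIntegrable g volume s t ∧
      x t = NormedSpace.exp ((t - s) • L) (x s) +
        ∫ r in s..t, NormedSpace.exp ((t - r) • L) (g r) := by
  have hxc := continuousOn_of_integral_equation hx
  have hXc : Continuous fun q => x (max q 0) :=
    hxc.comp_continuous (by fun_prop) fun q => mem_Ici.2 (le_max_right _ _)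
  have hLi : ∀ r, s ≤ r → IntervalIntegrable (fun q => L (x q)) volume s r := fun r hr => by
    refine ContinuousOn.intervalIntegrable ?_
    rw [uIcc_of_le hr]
    exact L.continuous.comp_continuousOn (hxc.mono fun q hq => hs.trans hq.1)
  have hfi : ∀ r, s ≤ r → IntervalIntegrable (fun q => L (x q) + g q) volume s r := fun r hr =>
    (hx s hs).1.symm.trans (hx r (hs.trans hr)).1
  have hgi : ∀ r, s ≤ r → IntervalIntegrable g volume s r := fun r hr => by
    simpa using! (hfi r hr).sub (hLi r hr)
  refine ⟨hgi t hst, ?_⟩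
  set G : ℝ → E := fun r => ∫ q in s..r, g q with hG
  -- Subtracting the primitive `G` of the forcing leaves a differentiable function `z` with
  -- `z' = L x = L z + L G`. Extending `x` to the left of `0` by a constant makes the integrand
  -- continuous on all of `ℝ`.
  set z : ℝ → E := fun r => x s + ∫ q in s..r, L (x (max q 0)) with hz
  have hxz : ∀ r, s ≤ r → x r = z r + G r := fun r hr => by
    have h1 : x r = x s + ∫ q in s..r, (L (x q) + g q) := by
      rw [(hx r (hs.trans hr)).2, (hx s hs).2, add_assoc,
        intervalIntegral.integral_add_adjacent_intervals (hx s hs).1 (hfi r hr)]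
    have h2 : ∫ q in s..r, L (x (max q 0)) = ∫ q in s..r, L (x q) := by
      refine intervalIntegral.integral_congr fun q hq => ?_
      rw [uIcc_of_le hr] at hq
      simp [max_eq_left (hs.trans hq.1)]
    rw [h1, intervalIntegral.integral_add (hLi r hr) (hgi r hr), hz, hG]
    simp only [h2, add_assoc]
  have hzd : ∀ r, HasDerivAt z (L (x (max r 0))) r := fun r =>
    (intervalIntegral.integral_hasDerivAt_right
      ((L.continuous.comp hXc).intervalIntegrable _ _)
      ((L.continuous.comp hXc).stronglyMeasurableAtFilter _ _)
      (L.continuous.comp hXc).continuousAt).const_add _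
  set Φ : ℝ → E →L[ℝ] E := fun r => NormedSpace.exp ((t - r) • L) with hΦ
  have hΦd : ∀ r, HasDerivAt Φ (-(Φ r * L)) r := hasDerivAt_exp_sub_smul L t
  have hΦc : Continuous Φ := continuous_iff_continuousAt.2 fun r => (hΦd r).continuousAt
  have hΦc' : Continuous fun r => -(Φ r * L) := (hΦc.mul continuous_const).neg
  have hzc : Continuous z := continuous_iff_continuousAt.2 fun r => (hzd r).continuousAt
  -- This is the derivative of `Φ r (z r)`, rewritten as a term to which
  -- `integral_deriv_apply_primitive` applies.
  have hGz : ∀ r ∈ uIcc s t, -((-(Φ r * L)) (G r)) =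
      (-(Φ r * L)) (z r) + Φ r (L (x (max r 0))) := fun r hr => by
    rw [uIcc_of_le hst] at hr
    rw [max_eq_left (hs.trans hr.1), hxz r hr.1]
    simp
  have hft := intervalIntegral.integral_eq_sub_of_hasDerivAt (a := s) (b := t)
    (fun r _ => (hΦd r).clm_apply (hzd r))
    (((hΦc'.clm_apply hzc).add (hΦc.clm_apply (L.continuous.comp hXc))).intervalIntegrable _ _)
  rw [← intervalIntegral.integral_congr hGz, intervalIntegral.integral_neg,
    integral_deriv_apply_primitive hΦd hΦc' hst (hgi t hst)] at hft
  have h1 : Φ t = 1 := by simp [hΦ]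
  have h2 : z s = x s := by simp [hz]
  rw [h1, h2] at hft
  simp only [one_apply_eq_self] at hft
  rw [hxz t hst]
  have h3 : z t + G t = Φ s (x s) + (∫ q in s..t, Φ q (g q)) := by
    rw [neg_sub] at hft
    rw [eq_comm, sub_eq_iff_eq_add] at hft
    rw [hft, hG]; abel
  exact h3

end VariationOfConstants

/-! ### The delay and its inverse -/

section Delay

variable {φ : ℝ → ℝ} (hφ : AdmissibleDelay φ)
include hφ

theorem AdmissibleDelay.hasDerivAt {t : ℝ} (ht : 0 < t) :
    HasDerivAt φ (derivWithin φ (Ici 0) t) t :=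
  ((hφ.contDiffOn.differentiableOn one_ne_zero t ht.le).hasDerivWithinAt).hasDerivAt
    (Ici_mem_nhds ht)

/-- A positive lower bound of the derivative of `φ`, together with the linear growth it implies. -/
theorem AdmissibleDelay.exists_mul_sub_le :
    ∃ c : ℝ, 0 < c ∧ (∀ s t : ℝ, 0 ≤ s → s ≤ t → c * (t - s) ≤ φ t - φ s) ∧
      ∀ t, 0 ≤ t → c ≤ derivWithin φ (Ici 0) t := by
  obtain ⟨c, _, hc, _, h⟩ := hφ.deriv_bdd
  refine ⟨c, hc, fun s t hs hst => ?_, fun t ht => (h t ht).1⟩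
  refine (convex_Ici (0 : ℝ)).mul_sub_le_image_sub_of_le_deriv hφ.contDiffOn.continuousOn
    ?_ ?_ s hs t (hs.trans hst) hst
  · rw [interior_Ici]
    exact fun x hx => (hφ.hasDerivAt hx).differentiableAt.differentiableWithinAt
  · rw [interior_Ici]
    intro x hx
    rw [(hφ.hasDerivAt hx).deriv]
    exact (h x (le_of_lt hx)).1

theorem AdmissibleDelay.strictMonoOn : StrictMonoOn φ (Ici 0) := by
  obtain ⟨c, hc, h, _⟩ := hφ.exists_mul_sub_le
  intro s hs t _ hst
  have := h s t hs hst.le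
  have := mul_pos hc (sub_pos.2 hst)
  linarith

theorem AdmissibleDelay.surjOn : SurjOn φ (Ici 0) (Ici (φ 0)) := by
  obtain ⟨c, hc, h, _⟩ := hφ.exists_mul_sub_le
  intro y hy
  have hy' : 0 ≤ (y - φ 0) / c := div_nonneg (sub_nonneg.2 hy) hc.le
  have h1 := h 0 _ le_rfl hy'
  rw [sub_zero, mul_div_cancel₀ _ hc.ne'] at h1
  obtain ⟨s, hs, rfl⟩ := intermediate_value_Icc hy'
    (hφ.contDiffOn.continuousOn.mono Icc_subset_Ici_self) ⟨hy, by linarith⟩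
  exact ⟨s, hs.1, rfl⟩

theorem AdmissibleDelay.zero_lt : φ 0 < 0 := by
  have := hφ.delay_pos 0 le_rfl
  linarith

theorem AdmissibleDelay.advance_apply {r : ℝ} (hr : 0 ≤ r) : advance φ (φ r) = r :=
  hφ.strictMonoOn.injOn.leftInvOn_invFunOn hr

theorem AdmissibleDelay.apply_advance {t : ℝ} (ht : φ 0 ≤ t) : φ (advance φ t) = t :=
  Function.invFunOn_eq (hφ.surjOn ht)

theorem AdmissibleDelay.advance_nonneg {t : ℝ} (ht : φ 0 ≤ t) : 0 ≤ advance φ t :=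
  Function.invFunOn_mem (hφ.surjOn ht)

theorem AdmissibleDelay.advance_strictMonoOn : StrictMonoOn (advance φ) (Ici (φ 0)) := by
  intro s hs t ht hst
  by_contra! h
  have := hφ.strictMonoOn.monotoneOn (hφ.advance_nonneg ht) (hφ.advance_nonneg hs) h
  rw [hφ.apply_advance hs, hφ.apply_advance ht] at this
  exact this.not_gt hst

theorem AdmissibleDelay.advance_le {s t : ℝ} (hs : φ 0 ≤ s) (hst : s ≤ t) :
    advance φ s ≤ advance φ t :=
  hφ.advance_strictMonoOn.monotoneOn hs (hs.trans hst) hst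

theorem AdmissibleDelay.lt_advance {t : ℝ} (ht : φ 0 ≤ t) : t < advance φ t := by
  have := hφ.delay_pos _ (hφ.advance_nonneg ht)
  rw [hφ.apply_advance ht] at this
  linarith

theorem AdmissibleDelay.advance_continuousOn : ContinuousOn (advance φ) (Ici (φ 0)) := by
  obtain ⟨c, hc, h, _⟩ := hφ.exists_mul_sub_le
  refine (LipschitzOnWith.of_le_add_mul' c⁻¹ fun s hs t ht => ?_).continuousOn
  rcases le_total (advance φ s) (advance φ t) with hst | hst
  · exact hst.trans (le_add_of_nonneg_right (by positivity))
  · have h1 := h _ _ (hφ.advance_nonneg ht) hst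
    rw [hφ.apply_advance hs, hφ.apply_advance ht] at h1
    have h2 : advance φ s - advance φ t ≤ c⁻¹ * dist s t := by
      rw [inv_mul_eq_div, le_div_iff₀ hc, mul_comm]
      exact h1.trans (le_abs_self _)
    linarith

theorem AdmissibleDelay.hasDerivAt_advance {t : ℝ} (ht : φ 0 < t) :
    HasDerivAt (advance φ) (derivWithin φ (Ici 0) (advance φ t))⁻¹ t := by
  obtain ⟨c, hc, _, h⟩ := hφ.exists_mul_sub_le
  have hpos : 0 < advance φ t := by
    have := hφ.advance_strictMonoOn (mem_Ici.2 le_rfl) ht.le ht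
    rwa [hφ.advance_apply le_rfl] at this
  -- At the end point `φ 0` the function `advance φ` has only a one-sided derivative, which is why
  -- `t` is taken in the interior.
  refine HasDerivAt.of_local_left_inverse
    ((hφ.advance_continuousOn t ht.le).continuousAt (Ici_mem_nhds ht)) (hφ.hasDerivAt hpos)
    (hc.trans_le (h _ hpos.le)).ne' ?_
  filter_upwards [Ici_mem_nhds ht] with y hy using hφ.apply_advance hy

theorem AdmissibleDelay.derivWithin_advance {t : ℝ} (ht : φ 0 < t) :
    derivWithin (advance φ) (Ici (φ 0)) t = (derivWithin φ (Ici 0) (advance φ t))⁻¹ := by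
  rw [derivWithin_of_mem_nhds (Ici_mem_nhds ht), (hφ.hasDerivAt_advance ht).deriv]

theorem AdmissibleDelay.derivWithin_advance_nonneg {t : ℝ} (ht : φ 0 < t) :
    0 ≤ derivWithin (advance φ) (Ici (φ 0)) t := by
  obtain ⟨c, hc, _, h⟩ := hφ.exists_mul_sub_le
  rw [hφ.derivWithin_advance ht]
  exact inv_nonneg.2 (hc.le.trans (h _ (hφ.advance_nonneg ht.le)))

theorem AdmissibleDelay.exists_derivWithin_advance_le :
    ∃ M : ℝ, 0 < M ∧ ∀ t, φ 0 < t → derivWithin (advance φ) (Ici (φ 0)) t ≤ M := by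
  obtain ⟨c, hc, _, h⟩ := hφ.exists_mul_sub_le
  refine ⟨c⁻¹, inv_pos.2 hc, fun t ht => ?_⟩
  rw [hφ.derivWithin_advance ht]
  exact inv_anti₀ hc (h _ (hφ.advance_nonneg ht.le))

theorem AdmissibleDelay.image_advance_Ioc {s t : ℝ} (hs : 0 ≤ s) (hst : s ≤ t) :
    advance φ '' Ioc (φ s) (φ t) = Ioc s t := by
  have hφs : ∀ r, 0 ≤ r → φ 0 ≤ φ r := fun r hr => hφ.strictMonoOn.monotoneOn (mem_Ici.2 le_rfl) hr hr
  ext r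
  constructor
  · rintro ⟨q, hq, rfl⟩
    have h0 : φ 0 ≤ q := (hφs s hs).trans hq.1.le
    have h1 := hφ.advance_strictMonoOn (hφs s hs) h0 hq.1
    have h2 := hφ.advance_le h0 hq.2
    rw [hφ.advance_apply hs] at h1
    rw [hφ.advance_apply (hs.trans hst)] at h2
    exact ⟨h1, h2⟩
  · intro hr
    have h0 : 0 ≤ r := hs.trans hr.1.le
    exact ⟨φ r, ⟨hφ.strictMonoOn hs h0 hr.1, hφ.strictMonoOn.monotoneOn h0 (hs.trans hst) hr.2⟩,
      hφ.advance_apply h0⟩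

/-- The substitution `r = σ q` in integrals over `[s, t]`. -/
theorem AdmissibleDelay.integral_substitution {F : Type*} [NormedAddCommGroup F] [NormedSpace ℝ F]
    {s t : ℝ} (hs : 0 ≤ s) (hst : s ≤ t) (f : ℝ → F) :
    ∫ r in s..t, f r =
      ∫ q in (φ s)..(φ t), derivWithin (advance φ) (Ici (φ 0)) q • f (advance φ q) := by
  have hφs : φ 0 ≤ φ s := hφ.strictMonoOn.monotoneOn (mem_Ici.2 le_rfl) hs hs
  have hφst : φ s ≤ φ t := hφ.strictMonoOn.monotoneOn hs (hs.trans hst) hst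
  rw [intervalIntegral.integral_of_le hst, intervalIntegral.integral_of_le hφst,
    ← hφ.image_advance_Ioc hs hst,
    integral_image_eq_integral_abs_deriv_smul measurableSet_Ioc
      (f' := derivWithin (advance φ) (Ici (φ 0)))]
  · refine setIntegral_congr_fun measurableSet_Ioc fun q hq => ?_
    simp only [abs_of_nonneg (hφ.derivWithin_advance_nonneg (hφs.trans_lt hq.1))]
  · intro q hq
    rw [hφ.derivWithin_advance (hφs.trans_lt hq.1)]
    exact (hφ.hasDerivAt_advance (hφs.trans_lt hq.1)).hasDerivWithinAt
  · exact hφ.advance_strictMonoOn.injOn.mono fun q hq => hφs.trans hq.1.le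

end Delay

/-! ### Matrices acting on Euclidean space -/

section Matrices

open scoped RealInnerProductSpace

theorem norm_act_le {k l : ℕ} (M : Matrix (Fin k) (Fin l) ℝ) (v : Vec l) :
    ‖act M v‖ ≤ inducedNorm M * ‖v‖ :=
  (LinearMap.toContinuousLinearMap (Matrix.toEuclideanLin M)).le_opNorm v

theorem inducedNorm_nonneg {k l : ℕ} (M : Matrix (Fin k) (Fin l) ℝ) : 0 ≤ inducedNorm M :=
  norm_nonneg _

theorem act_mul {k l j : ℕ} (M : Matrix (Fin k) (Fin l) ℝ) (N : Matrix (Fin l) (Fin j) ℝ)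
    (v : Vec j) : act (M * N) v = act M (act N v) := by
  ext i
  simp [act, Matrix.toLpLin_apply]

theorem act_add {k l : ℕ} (M N : Matrix (Fin k) (Fin l) ℝ) (v : Vec l) :
    act (M + N) v = act M v + act N v := by
  simp [act]

theorem act_sub {k l : ℕ} (M : Matrix (Fin k) (Fin l) ℝ) (v w : Vec l) :
    act M (v - w) = act M v - act M w :=
  map_sub _ v w

/-- The matrix exponential acts as the exponential in the Banach algebra of continuous linear maps. -/
theorem act_exp_smul {n : ℕ} (A : Matrix (Fin n) (Fin n) ℝ) (c : ℝ) (v : Vec n) :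
    act (NormedSpace.exp (c • A)) v =
      NormedSpace.exp (c • Matrix.toEuclideanCLM (𝕜 := ℝ) A) v := by
  open scoped Matrix.Norms.L2Operator in
  let _ : NormedAlgebra ℚ (Matrix (Fin n) (Fin n) ℝ) := NormedAlgebra.restrictScalars ℚ ℝ _
  open scoped Matrix.Norms.L2Operator in
  have h := NormedSpace.map_exp (Matrix.toEuclideanCLM (n := Fin n) (𝕜 := ℝ))
    (AddMonoidHomClass.continuous_of_bound (Matrix.toEuclideanCLM (n := Fin n) (𝕜 := ℝ)) 1
      fun M => by rw [one_mul, Matrix.l2_opNorm_toEuclideanCLM]) (c • A)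
  rw [map_smul] at h
  rw [← h]
  rfl

theorem inner_act_left {k l : ℕ} (M : Matrix (Fin k) (Fin l) ℝ) (v : Vec l) (w : Vec k) :
    ⟪act M v, w⟫ = ⟪v, act M.transpose w⟫ := by
  have h := Matrix.toEuclideanLin_conjTranspose_eq_adjoint M
  rw [Matrix.conjTranspose_eq_transpose_of_trivial] at h
  unfold act
  rw [h, LinearMap.adjoint_inner_right]

/-- The quadratic form of a symmetric matrix in an orthonormal basis of eigenvectors. -/
theorem inner_act_eq_sum {n : ℕ} {M : Matrix (Fin n) (Fin n) ℝ} (hM : M.IsHermitian) (v : Vec n) :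
    ⟪v, act M v⟫ = ∑ i, hM.eigenvalues i * ⟪hM.eigenvectorBasis i, v⟫ ^ 2 := by
  rw [← hM.eigenvectorBasis.sum_inner_mul_inner]
  refine Finset.sum_congr rfl fun i _ => ?_
  have h1 : act M (hM.eigenvectorBasis i) = hM.eigenvalues i • hM.eigenvectorBasis i := by
    have h := hM.mulVec_eigenvectorBasis i
    ext j
    simpa [act, Matrix.toLpLin_apply] using congrFun h j
  have h2 : ⟪hM.eigenvectorBasis i, act M v⟫ = hM.eigenvalues i * ⟪hM.eigenvectorBasis i, v⟫ := by
    have h3 := inner_act_left M (hM.eigenvectorBasis i) v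
    rw [← Matrix.conjTranspose_eq_transpose_of_trivial, hM.eq, h1, real_inner_smul_left] at h3
    exact h3.symm
  rw [h2, real_inner_comm v]
  ring

theorem lambdaMin_mul_norm_sq_le {n : ℕ} {M : Matrix (Fin n) (Fin n) ℝ} (hM : M.IsHermitian)
    (v : Vec n) : lambdaMin M * ‖v‖ ^ 2 ≤ ⟪v, act M v⟫ := by
  rw [inner_act_eq_sum hM, ← hM.eigenvectorBasis.sum_sq_inner_right, Finset.mul_sum]
  refine Finset.sum_le_sum fun i _ => mul_le_mul_of_nonneg_right ?_ (sq_nonneg _)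
  exact csInf_le (Matrix.finite_real_spectrum).bddBelow (hM.eigenvalues_mem_spectrum_real i)

theorem inner_act_le_lambdaMax_mul {n : ℕ} {M : Matrix (Fin n) (Fin n) ℝ} (hM : M.IsHermitian)
    (v : Vec n) : ⟪v, act M v⟫ ≤ lambdaMax M * ‖v‖ ^ 2 := by
  rw [inner_act_eq_sum hM, ← hM.eigenvectorBasis.sum_sq_inner_right, Finset.mul_sum]
  refine Finset.sum_le_sum fun i _ => mul_le_mul_of_nonneg_right ?_ (sq_nonneg _)
  exact le_csSup (Matrix.finite_real_spectrum).bddAbove (hM.eigenvalues_mem_spectrum_real i)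

theorem lambdaMin_pos {n : ℕ} [NeZero n] {M : Matrix (Fin n) (Fin n) ℝ} (hM : M.PosDef) :
    0 < lambdaMin M := by
  have h : lambdaMin M ∈ spectrum ℝ M :=
    Set.Nonempty.csInf_mem ⟨_, hM.1.eigenvalues_mem_spectrum_real 0⟩ Matrix.finite_real_spectrum
  rw [hM.1.spectrum_real_eq_range_eigenvalues] at h
  obtain ⟨i, hi⟩ := h
  rw [← hi]
  exact hM.eigenvalues_pos i

theorem lambdaMax_pos {n : ℕ} [NeZero n] {M : Matrix (Fin n) (Fin n) ℝ} (hM : M.PosDef) :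
    0 < lambdaMax M :=
  (hM.eigenvalues_pos 0).trans_le
    (le_csSup (Matrix.finite_real_spectrum).bddAbove (hM.1.eigenvalues_mem_spectrum_real 0))

theorem inducedNorm_pos {k l : ℕ} {M : Matrix (Fin k) (Fin l) ℝ} (hM : M ≠ 0) :
    0 < inducedNorm M := by
  refine norm_pos_iff.2 fun h => hM ?_
  have : Matrix.toEuclideanLin M = 0 := by simpa using h
  simpa using this

theorem mul_ne_zero_of_posDef {n m : ℕ} {P : Matrix (Fin n) (Fin n) ℝ} (hP : P.PosDef)
    {B : Matrix (Fin n) (Fin m) ℝ} (hB : B ≠ 0) : P * B ≠ 0 := by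
  intro h
  apply hB
  have hu : IsUnit P.det := hP.det_pos.ne'.isUnit
  rw [← Matrix.nonsing_inv_mul_cancel_left P B hu, h, Matrix.mul_zero]

/-- The Lyapunov equation as an identity of quadratic forms. -/
theorem two_mul_inner_of_lyapunov {n : ℕ} {F P Q : Matrix (Fin n) (Fin n) ℝ}
    (h : F.transpose * P + P * F = -Q) (v : Vec n) (hP : P.IsHermitian) :
    2 * ⟪act P v, act F v⟫ = -⟪v, act Q v⟫ := by
  have hPt : P.transpose = P := by
    rw [← Matrix.conjTranspose_eq_transpose_of_trivial]; exact hP.eq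
  have h1 : ⟪act P v, act F v⟫ = ⟪v, act (P * F) v⟫ := by
    rw [inner_act_left, hPt, act_mul]
  have h2 : ⟪act P v, act F v⟫ = ⟪v, act (F.transpose * P) v⟫ := by
    rw [real_inner_comm, inner_act_left, act_mul]
  have h3 : act (F.transpose * P) v + act (P * F) v = -act Q v := by
    rw [← act_add, h]; simp [act]
  rw [two_mul]
  nth_rewrite 1 [h2]
  rw [h1, ← inner_add_right, h3, inner_neg_right]

end Matrices

/-! ### The plant under a held input -/

section Flow

open scoped RealInnerProductSpace

variable {n m : ℕ} {A : Matrix (Fin n) (Fin n) ℝ} {B : Matrix (Fin n) (Fin m) ℝ} {φ : ℝ → ℝ}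
  {x : ℝ → Vec n} {u : ℝ → Vec m}

theorem hasDerivAt_act {k l : ℕ} (M : Matrix (Fin k) (Fin l) ℝ) {y : ℝ → Vec l} {y' : Vec l}
    {r : ℝ} (hy : HasDerivAt y y' r) : HasDerivAt (fun s => act M (y s)) (act M y') r :=
  (LinearMap.toContinuousLinearMap (Matrix.toEuclideanLin M)).hasFDerivAt.comp_hasDerivAt r hy

theorem continuous_act {k l : ℕ} (M : Matrix (Fin k) (Fin l) ℝ) :
    Continuous fun v : Vec l => act M v :=
  (LinearMap.toContinuousLinearMap (Matrix.toEuclideanLin M)).continuous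

theorem IsPlantSolution.continuousOn (hx : IsPlantSolution A B φ x u) : ContinuousOn x (Ici 0) :=
  continuousOn_of_integral_equation hx

theorem IsPlantSolution.variation_of_constants (hx : IsPlantSolution A B φ x u) {s t : ℝ}
    (hs : 0 ≤ s) (hst : s ≤ t) :
    IntervalIntegrable (fun r => act B (u (φ r))) volume s t ∧
      x t = act (NormedSpace.exp ((t - s) • A)) (x s) +
        ∫ r in s..t, act (NormedSpace.exp ((t - r) • A)) (act B (u (φ r))) := by
  simp only [act_exp_smul]
  exact EventTrigger.variation_of_constants (L := Matrix.toEuclideanCLM (n := Fin n) (𝕜 := ℝ) A)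
    (g := fun r => act B (u (φ r))) hx hs hst

/-- The predictor at time `t ≥ 0` is the state at time `σ t`. -/
theorem predictor_eq (hφ : AdmissibleDelay φ) (hx : IsPlantSolution A B φ x u) {t : ℝ}
    (ht : 0 ≤ t) : predictor A B φ x u t = x (advance φ t) := by
  have h0 : φ 0 ≤ t := hφ.zero_lt.le.trans ht
  have hlt := (hφ.lt_advance h0).le
  rw [predictor, max_eq_left ht, (hx.variation_of_constants ht hlt).2,
    hφ.integral_substitution ht hlt, hφ.apply_advance h0]
  congr 1
  refine intervalIntegral.integral_congr fun s hs => ?_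
  have hφt : φ 0 ≤ φ t := hφ.strictMonoOn.monotoneOn (mem_Ici.2 le_rfl) ht ht
  rw [uIcc_of_le (by linarith [hφ.delay_pos t ht])] at hs
  simp only [hφ.apply_advance (hφt.trans hs.1)]

/-- While the delayed input is constant on `[a, b)`, the state coincides on `[a, b]` with a function `y`
that is differentiable in the classical sense, also at the end points. -/
theorem IsPlantSolution.exists_hasDerivAt (hx : IsPlantSolution A B φ x u) {a b : ℝ}
    (ha : 0 ≤ a) {w : Vec m} (hu : ∀ s ∈ Ico a b, u (φ s) = w) :
    ∃ y : ℝ → Vec n, (∀ r ∈ Icc a b, x r = y r) ∧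
      ∀ r ∈ Icc a b, HasDerivAt y (act A (y r) + act B w) r := by
  have hXc : Continuous fun q => act A (x (max q 0)) + act B w :=
    ((continuous_act A).comp (hx.continuousOn.comp_continuous (by fun_prop) fun q =>
      mem_Ici.2 (le_max_right _ _))).add continuous_const
  refine ⟨fun r => x a + ∫ q in a..r, (act A (x (max q 0)) + act B w), ?_⟩
  have hy : ∀ r ∈ Icc a b, x r = x a + ∫ q in a..r, (act A (x (max q 0)) + act B w) := by
    intro r hr
    have hfi : IntervalIntegrable (fun s => act A (x s) + act B (u (φ s))) volume a r :=
      (hx a ha).1.symm.trans (hx r (ha.trans hr.1)).1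
    rw [(hx r (ha.trans hr.1)).2, (hx a ha).2, add_assoc,
      ← intervalIntegral.integral_add_adjacent_intervals (hx a ha).1 hfi]
    congr 2
    refine intervalIntegral.integral_congr_ae ?_
    have hr' : ∀ᵐ q : ℝ, q ≠ r := by simp [ae_iff]
    filter_upwards [hr'] with q hqr hq
    rw [uIoc_of_le hr.1] at hq
    have hqb : q < b := (lt_of_le_of_ne hq.2 hqr).trans_le hr.2
    rw [hu q ⟨hq.1.le, hqb⟩, max_eq_left (ha.trans hq.1.le)]
  refine ⟨hy, fun r hr => ?_⟩
  have hd := (intervalIntegral.integral_hasDerivAt_right (hXc.intervalIntegrable a r)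
    (hXc.stronglyMeasurableAtFilter _ _) hXc.continuousAt).const_add (x a)
  simp only [← hy r hr]
  simpa [max_eq_left (ha.trans hr.1)] using hd

variable {K : Matrix (Fin m) (Fin n) ℝ} {P Q : Matrix (Fin n) (Fin n) ℝ} {y : ℝ → Vec n} {a b : ℝ}

/-- Gronwall bound for the deviation from the sample `y a` under the feedback `K (y a)`; it is
proportional to `‖y a‖`. -/
theorem norm_sub_le_of_sampled_feedback
    (hy : ∀ r ∈ Icc a b, HasDerivAt y (act A (y r) + act B (act K (y a))) r) :
    ∀ r ∈ Icc a b, ‖y r - y a‖ ≤ inducedNorm (A + B * K) * ‖y a‖ / (inducedNorm A + 1) *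
      (Real.exp ((inducedNorm A + 1) * (r - a)) - 1) := by
  intro r hr
  have hA : 0 ≤ inducedNorm A := inducedNorm_nonneg A
  have h := norm_le_gronwallBound_of_norm_deriv_right_le (f := fun r => y r - y a)
    (f' := fun r => act A (y r) + act B (act K (y a))) (δ := 0) (K := inducedNorm A + 1)
    (ε := inducedNorm (A + B * K) * ‖y a‖) (a := a) (b := b)
    (fun r hr => (((hy r hr).sub_const _).continuousAt).continuousWithinAt)
    (fun r hr => ((hy r (Ico_subset_Icc_self hr)).sub_const _).hasDerivWithinAt)
    (by simp) (fun r hr => ?_) r hr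
  · rw [gronwallBound_of_K_ne_0 (by linarith)] at h
    simpa only [zero_mul, zero_add] using h
  · have h1 : act A (y r) + act B (act K (y a)) =
        act A (y r - y a) + act (A + B * K) (y a) := by
      rw [act_add, act_mul, act_sub]; abel
    rw [h1]
    refine (norm_add_le _ _).trans (add_le_add ((norm_act_le _ _).trans ?_) (norm_act_le _ _))
    nlinarith [norm_nonneg (y r - y a)]

/-- Under the trigger inequality, `⟪y, P y⟫` decays at the rate `(2 - θ) λ_min(Q) / (4 λ_max(P))` along
the system with sampled feedback. -/
theorem lyapunov_decay {θ : ℝ} (hP : P.PosDef) (hQ : Q.PosDef) (hθ₀ : 0 < θ) (hθ₁ : θ < 1) (hn : n ≠ 0)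
    (hLyap : (A + B * K).transpose * P + P * (A + B * K) = -Q)
    (hy : ∀ r ∈ Icc a b, HasDerivAt y (act A (y r) + act B (act K (y a))) r)
    (htrig : ∀ r ∈ Ico a b, 4 * inducedNorm (P * B) * inducedNorm K * ‖y a - y r‖ ≤
      lambdaMin Q * √θ * ‖y r‖) :
    AntitoneOn (fun r => ⟪y r, act P (y r)⟫ *
      Real.exp ((2 - θ) * lambdaMin Q / (4 * lambdaMax P) * r)) (Icc a b) := by
  have : NeZero n := ⟨hn⟩
  set μ := (2 - θ) * lambdaMin Q / (4 * lambdaMax P) with hμ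
  have hPm := lambdaMax_pos hP
  have hQm := lambdaMin_pos hQ
  have hder : ∀ r ∈ Icc a b, HasDerivAt (fun r => ⟪y r, act P (y r)⟫ * Real.exp (μ * r))
      ((⟪y r, act P (act A (y r) + act B (act K (y a)))⟫ +
        ⟪act A (y r) + act B (act K (y a)), act P (y r)⟫) * Real.exp (μ * r) +
        ⟪y r, act P (y r)⟫ * (Real.exp (μ * r) * μ)) r := by
    intro r hr
    have he : HasDerivAt (fun r => Real.exp (μ * r)) (Real.exp (μ * r) * μ) r := by
      simpa using ((hasDerivAt_id r).const_mul μ).exp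
    exact ((hy r hr).inner ℝ (hasDerivAt_act P (hy r hr))).mul he
  refine antitoneOn_of_deriv_nonpos (convex_Icc a b)
    (fun r hr => (hder r hr).continuousAt.continuousWithinAt)
    (fun r hr => (hder r (interior_subset hr)).differentiableAt.differentiableWithinAt) ?_
  rw [interior_Icc]
  intro r hr
  rw [(hder r (Ioo_subset_Icc_self hr)).deriv]
  set v := y r with hv
  set e := y a - y r with he
  have hPt : P.transpose = P := by
    rw [← Matrix.conjTranspose_eq_transpose_of_trivial]; exact hP.1.eq
  have h1 : act A v + act B (act K (y a)) = act (A + B * K) v + act B (act K e) := by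
    rw [act_add, act_mul, he, act_sub, act_sub]; abel
  have h2 : ⟪v, act P (act A v + act B (act K (y a)))⟫ =
      ⟪act P v, act A v + act B (act K (y a))⟫ := by
    rw [inner_act_left, hPt]
  have h3 : ⟪act P v, act B (act K e)⟫ ≤ inducedNorm (P * B) * inducedNorm K * ‖e‖ * ‖v‖ := by
    rw [inner_act_left, hPt, ← act_mul]
    refine (real_inner_le_norm _ _).trans ?_
    rw [mul_comm]
    refine mul_le_mul_of_nonneg_right ?_ (norm_nonneg _)
    refine (norm_act_le _ _).trans ?_
    rw [mul_assoc]
    exact mul_le_mul_of_nonneg_left (norm_act_le _ _) (inducedNorm_nonneg _)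
  have h4 := two_mul_inner_of_lyapunov hLyap v hP.1
  have h5 := lambdaMin_mul_norm_sq_le hQ.1 v
  have h6 := inner_act_le_lambdaMax_mul hP.1 v
  have h7 := mul_le_mul_of_nonneg_right (htrig r (Ioo_subset_Ico_self hr)) (norm_nonneg v)
  have hq : √θ ^ 2 = θ := Real.sq_sqrt hθ₀.le
  rw [h2, real_inner_comm (act P v), h1, inner_add_right]
  have hθ : 0 ≤ 2 - θ := by linarith
  have hμ0 : 0 ≤ μ := by positivity
  have h8 : ⟪v, act P v⟫ * μ ≤ (2 - θ) * lambdaMin Q / 4 * ‖v‖ ^ 2 := by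
    refine (mul_le_mul_of_nonneg_right h6 hμ0).trans (le_of_eq ?_)
    rw [hμ]; field_simp
  -- The rate `(1 - √θ / 2) λ_min(Q) / λ_max(P)` dominates `μ` because `θ - 2 √θ + 2 ≥ 0`.
  have h9 : 0 ≤ lambdaMin Q * ‖v‖ ^ 2 * ((√θ - 1) ^ 2 + 1) := by positivity
  have h10 : ⟪act P v, act (A + B * K) v⟫ + ⟪act P v, act B (act K e)⟫ +
      (⟪act P v, act (A + B * K) v⟫ + ⟪act P v, act B (act K e)⟫) + ⟪v, act P v⟫ * μ ≤ 0 := by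
    have h11 : (√θ - 1) ^ 2 + 1 = θ - 2 * √θ + 2 := by rw [sub_sq, hq]; ring
    rw [h11] at h9
    nlinarith
  nlinarith [Real.exp_pos (μ * r)]

end Flow

/-! ### The event-triggered closed loop -/

section ClosedLoop

open scoped RealInnerProductSpace

theorem IsEventSequence.of_succ {n m : ℕ} {B : Matrix (Fin n) (Fin m) ℝ}
    {K : Matrix (Fin m) (Fin n) ℝ} {P Q : Matrix (Fin n) (Fin n) ℝ} {θ : ℝ} {p : ℝ → Vec n}
    {T : ℕ → WithTop ℝ} (h : IsEventSequence B K P Q θ p T) {k : ℕ} {τ' : ℝ}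
    (hk : T (k + 1) = τ') :
    ∃ τ : ℝ, T k = τ ∧ τ' ∈ triggerSet B K P Q θ p τ := by
  have hne : T k ≠ ⊤ := fun htop => by
    rw [h.succ_top k htop] at hk
    exact WithTop.top_ne_coe hk
  obtain ⟨τ, hτ⟩ := WithTop.ne_top_iff_exists.1 hne
  refine ⟨τ, hτ.symm, ?_⟩
  rcases (h.succ k τ hτ.symm).1 with h1 | ⟨s, hs, h1⟩
  · rw [hk] at h1
    exact absurd h1 WithTop.coe_ne_top
  · rw [hk] at h1
    rwa [← WithTop.coe_injective h1]

theorem IsEventSequence.nonneg {n m : ℕ} {B : Matrix (Fin n) (Fin m) ℝ}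
    {K : Matrix (Fin m) (Fin n) ℝ} {P Q : Matrix (Fin n) (Fin n) ℝ} {θ : ℝ} {p : ℝ → Vec n}
    {T : ℕ → WithTop ℝ} (h : IsEventSequence B K P Q θ p T) {k : ℕ} {τ : ℝ}
    (hk : T k = τ) : 0 ≤ τ := by
  induction k generalizing τ with
  | zero =>
    rw [h.zero] at hk
    exact (WithTop.coe_injective hk).le
  | succ k ih =>
    obtain ⟨s, hs, hτ⟩ := h.of_succ hk
    exact (ih hs).trans hτ.1.le

variable {n m : ℕ} {A : Matrix (Fin n) (Fin n) ℝ} {B : Matrix (Fin n) (Fin m) ℝ}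
  {K : Matrix (Fin m) (Fin n) ℝ} {P Q : Matrix (Fin n) (Fin n) ℝ} {θ : ℝ} {φ : ℝ → ℝ}
  {x : ℝ → Vec n} {u : ℝ → Vec m} {T : ℕ → WithTop ℝ}

/-- Between events, in the time variable `r = σ t`, the state obeys the system with sampled feedback. -/
theorem IsClosedLoop.exists_hasDerivAt (h : IsClosedLoop A B K P Q θ φ x u T)
    (hφ : AdmissibleDelay φ) {k : ℕ} {τ t : ℝ} (hk : T k = τ) (hτt : τ ≤ t)
    (ht : (t : WithTop ℝ) ≤ T (k + 1)) :
    ∃ y : ℝ → Vec n, (∀ r ∈ Icc (advance φ τ) (advance φ t), x r = y r) ∧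
      ∀ r ∈ Icc (advance φ τ) (advance φ t),
        HasDerivAt y (act A (y r) + act B (act K (y (advance φ τ)))) r := by
  have hτ := h.events.nonneg hk
  have hτ' : φ 0 ≤ τ := hφ.zero_lt.le.trans hτ
  have hσ := hφ.advance_nonneg hτ'
  obtain ⟨y, hxy, hy⟩ := h.plant.exists_hasDerivAt hσ (b := advance φ t)
    (w := act K (x (advance φ τ))) (fun s hs => by
      have hs0 : 0 ≤ s := hσ.trans hs.1
      have h1 : τ ≤ φ s := by
        have := hφ.strictMonoOn.monotoneOn hσ hs0 hs.1
        rwa [hφ.apply_advance hτ'] at this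
      have h2 : φ s < t := by
        by_contra! h2
        have := hφ.advance_le (hτ'.trans hτt) h2
        rw [hφ.advance_apply hs0] at this
        exact this.not_gt hs.2
      rw [h.control k τ hk (φ s) h1 (lt_of_lt_of_le (WithTop.coe_lt_coe.2 h2) ht),
        predictor_eq hφ h.plant hτ])
  refine ⟨y, hxy, fun r hr => ?_⟩
  rw [← hxy (advance φ τ) ⟨le_rfl, hr.1.trans hr.2⟩]
  exact hy r hr

theorem IsClosedLoop.norm_sub_le (h : IsClosedLoop A B K P Q θ φ x u T)
    (hφ : AdmissibleDelay φ) {k : ℕ} {τ t : ℝ} (hk : T k = τ) (hτt : τ ≤ t)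
    (ht : (t : WithTop ℝ) ≤ T (k + 1)) :
    ‖x (advance φ t) - x (advance φ τ)‖ ≤
      inducedNorm (A + B * K) * ‖x (advance φ τ)‖ / (inducedNorm A + 1) *
        (Real.exp ((inducedNorm A + 1) * (advance φ t - advance φ τ)) - 1) := by
  have hle := hφ.advance_le (hφ.zero_lt.le.trans (h.events.nonneg hk)) hτt
  obtain ⟨y, hxy, hy⟩ := h.exists_hasDerivAt hφ hk hτt ht
  rw [hxy _ (left_mem_Icc.2 hle), hxy _ (right_mem_Icc.2 hle)]
  exact norm_sub_le_of_sampled_feedback hy _ (right_mem_Icc.2 hle)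

/-- Consecutive events are separated, in the time variable `σ t`, by a positive constant that does not
depend on the trajectory. -/
theorem exists_dwell_time (hn : n ≠ 0) (hQ : Q.PosDef) (hθ₀ : 0 < θ) :
    ∃ d : ℝ, 0 < d ∧ ∀ (φ : ℝ → ℝ) (x : ℝ → Vec n) (u : ℝ → Vec m) (T : ℕ → WithTop ℝ),
      AdmissibleDelay φ → IsClosedLoop A B K P Q θ φ x u T →
      ∀ (k : ℕ) (τ τ' : ℝ), T k = τ → T (k + 1) = τ' → d ≤ advance φ τ' - advance φ τ := by
  have : NeZero n := ⟨hn⟩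
  have hl : 0 < lambdaMin Q * √θ := mul_pos (lambdaMin_pos hQ) (Real.sqrt_pos.2 hθ₀)
  have hα : 0 < inducedNorm A + 1 := by linarith [inducedNorm_nonneg A]
  have hκ : 0 ≤ 4 * inducedNorm (P * B) * inducedNorm K := by
    have := inducedNorm_nonneg (P * B)
    have := inducedNorm_nonneg K
    positivity
  have hc : 0 ≤ inducedNorm (A + B * K) / (inducedNorm A + 1) :=
    div_nonneg (inducedNorm_nonneg _) hα.le
  set l := lambdaMin Q * √θ
  set κ := 4 * inducedNorm (P * B) * inducedNorm K
  set α := inducedNorm A + 1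
  set c := inducedNorm (A + B * K) / α with hcdef
  have hden : 0 < (κ + l) * c + 1 := by positivity
  -- At an event `κ ‖e‖ = l ‖p‖`, hence `l ‖p_k‖ ≤ (κ + l) ‖e‖ ≤ (κ + l) c ‖p_k‖ (exp (α Δ) - 1)`.
  -- The choice of `d` makes this impossible for `Δ < d`; the `+ 1` covers `(κ + l) c = 0`.
  refine ⟨Real.log (1 + l / ((κ + l) * c + 1)) / α, div_pos (Real.log_pos ?_) hα, ?_⟩
  · linarith [div_pos hl hden]
  intro φ x u T hφ h k τ τ' hk hk'
  obtain ⟨s, hs, hτ', hp, heq⟩ := h.events.of_succ hk'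
  obtain rfl : s = τ := WithTop.coe_injective (hs.symm.trans hk)
  have hs0 := h.events.nonneg hs
  have hb := h.norm_sub_le hφ hs hτ'.le hk'.ge
  rw [predictor_eq hφ h.plant hs0, predictor_eq hφ h.plant (hs0.trans hτ'.le), norm_sub_rev] at heq
  rw [predictor_eq hφ h.plant (hs0.trans hτ'.le)] at hp
  set v := x (advance φ s)
  set w := x (advance φ τ')
  set Δ := advance φ τ' - advance φ s
  by_contra! hlt
  rw [lt_div_iff₀ hα, mul_comm] at hlt
  have hexp : Real.exp (α * Δ) - 1 < l / ((κ + l) * c + 1) := by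
    have h1 := Real.exp_lt_exp.2 hlt
    rw [Real.exp_log (by linarith [div_pos hl hden])] at h1
    linarith
  have hb' : ‖w - v‖ ≤ c * ‖v‖ * (Real.exp (α * Δ) - 1) := by
    rwa [mul_div_right_comm] at hb
  -- A vanishing sample `v` would force `w = 0`, but events occur only at nonzero predictions.
  have hv : v ≠ 0 := by
    intro hv
    rw [hv] at hb'
    simp only [norm_zero, mul_zero, zero_mul, sub_zero] at hb'
    exact hp (norm_le_zero_iff.1 hb')
  have hvpos := norm_pos_iff.2 hv
  have htri : ‖v‖ ≤ ‖w‖ + ‖w - v‖ := by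
    have := norm_sub_le w (w - v)
    rwa [sub_sub_cancel] at this
  have h1 : l * ‖v‖ ≤ (κ + l) * ‖w - v‖ := by nlinarith
  have h2 : l * ‖v‖ ≤ (κ + l) * c * (Real.exp (α * Δ) - 1) * ‖v‖ :=
    h1.trans (by nlinarith [mul_le_mul_of_nonneg_left hb' (add_nonneg hκ hl.le)])
  have h3 : l ≤ (κ + l) * c * (Real.exp (α * Δ) - 1) := le_of_mul_le_mul_right h2 hvpos
  have h4 : (κ + l) * c * (Real.exp (α * Δ) - 1) ≤ (κ + l) * c * (l / ((κ + l) * c + 1)) :=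
    mul_le_mul_of_nonneg_left hexp.le (by positivity)
  have h5 : (κ + l) * c * (l / ((κ + l) * c + 1)) < l := by
    rw [← mul_div_assoc, div_lt_iff₀ hden]
    nlinarith
  linarith

/-- Events do not accumulate: every `t ≥ 0` lies in an event interval. -/
theorem IsClosedLoop.exists_event_le (h : IsClosedLoop A B K P Q θ φ x u T)
    (hφ : AdmissibleDelay φ) (hn : n ≠ 0) (hQ : Q.PosDef) (hθ₀ : 0 < θ) {t : ℝ} (ht : 0 ≤ t) :
    ∃ (k : ℕ) (τ : ℝ), T k = τ ∧ τ ≤ t ∧ (t : WithTop ℝ) < T (k + 1) := by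
  by_contra! hcon
  have hall : ∀ k, ∃ τ : ℝ, T k = τ ∧ τ ≤ t := by
    intro k
    induction k with
    | zero => exact ⟨0, h.events.zero, ht⟩
    | succ k ih =>
      obtain ⟨τ, hτ, hτt⟩ := ih
      have h1 := hcon k τ hτ hτt
      obtain ⟨τ', hτ'⟩ := WithTop.ne_top_iff_exists.1 (h1.trans_lt (WithTop.coe_lt_top t)).ne
      exact ⟨τ', hτ'.symm, by rwa [← hτ', WithTop.coe_le_coe] at h1⟩
  obtain ⟨d, hd, hdw⟩ := exists_dwell_time (A := A) (B := B) (K := K) (P := P) hn hQ hθ₀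
  have hgrow : ∀ (k : ℕ) (τ : ℝ), T k = τ → advance φ 0 + k * d ≤ advance φ τ := by
    intro k
    induction k with
    | zero =>
      intro τ hτ
      rw [h.events.zero] at hτ
      obtain rfl : 0 = τ := WithTop.coe_injective hτ
      simp
    | succ k ih =>
      intro τ' hτ'
      obtain ⟨τ, hτ, _⟩ := h.events.of_succ hτ'
      have h1 := hdw φ x u T hφ h k τ τ' hτ hτ'
      have h2 := ih τ hτ
      push_cast
      linarith
  obtain ⟨k, hkd⟩ := exists_nat_gt ((advance φ t - advance φ 0) / d)
  obtain ⟨τ, hτ, hτt⟩ := hall k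
  have h1 := hgrow k τ hτ
  have h2 := hφ.advance_le (hφ.zero_lt.le.trans (h.events.nonneg hτ)) hτt
  rw [div_lt_iff₀ hd] at hkd
  linarith

/-- The trigger inequality holds on the whole event interval. -/
theorem IsClosedLoop.trigger_le (h : IsClosedLoop A B K P Q θ φ x u T)
    (hφ : AdmissibleDelay φ) (hn : n ≠ 0) (hQ : Q.PosDef) (hθ₀ : 0 < θ) {k : ℕ}
    {τ t : ℝ} (hk : T k = τ) (hτt : τ ≤ t) (ht : (t : WithTop ℝ) < T (k + 1)) :
    4 * inducedNorm (P * B) * inducedNorm K * ‖x (advance φ τ) - x (advance φ t)‖ ≤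
      lambdaMin Q * √θ * ‖x (advance φ t)‖ := by
  have : NeZero n := ⟨hn⟩
  have hτ := h.events.nonneg hk
  have hl : 0 < lambdaMin Q * √θ := mul_pos (lambdaMin_pos hQ) (Real.sqrt_pos.2 hθ₀)
  by_contra! hlt
  have hpc : ContinuousOn (fun s => x (advance φ s)) (Icc τ t) := by
    refine h.plant.continuousOn.comp (hφ.advance_continuousOn.mono fun s hs => ?_) fun s hs => ?_
    · exact hφ.zero_lt.le.trans (hτ.trans hs.1)
    · exact hφ.advance_nonneg (hφ.zero_lt.le.trans (hτ.trans hs.1))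
  have hfc : ContinuousOn (fun s => lambdaMin Q * √θ * ‖x (advance φ s)‖ -
      4 * inducedNorm (P * B) * inducedNorm K * ‖x (advance φ τ) - x (advance φ s)‖) (Icc τ t) :=
    (continuousOn_const.mul hpc.norm).sub (continuousOn_const.mul (continuousOn_const.sub hpc).norm)
  obtain ⟨s, hs, hs0⟩ := intermediate_value_Icc' hτt hfc
    (show (0 : ℝ) ∈ _ from ⟨by linarith, by
      rw [sub_self, norm_zero, mul_zero, sub_zero]; positivity⟩)
  simp only at hs0
  -- A zero `s` of the difference of the two sides is an event, unless the prediction vanishes at `s`.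
  -- In that case the sample vanishes (and then so does the prediction on the whole interval), or the
  -- left-hand side is identically zero.
  by_cases hps : x (advance φ s) = 0
  · rw [hps] at hs0
    simp only [norm_zero, mul_zero, sub_zero, zero_sub, neg_eq_zero, mul_eq_zero] at hs0
    rcases hs0 with hs0 | hs0
    · have hz : 4 * inducedNorm (P * B) * inducedNorm K = 0 := by
        rcases hs0 with hs0 | hs0
        · rcases hs0 with hs0 | hs0
          · norm_num at hs0
          · simp [hs0]
        · simp [hs0]
      rw [hz, zero_mul] at hlt
      exact absurd hlt (not_lt.2 (mul_nonneg hl.le (norm_nonneg _)))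
    · have hb := h.norm_sub_le hφ hk hτt ht.le
      rw [hs0] at hb
      simp only [mul_zero, zero_div, zero_mul] at hb
      have he := norm_le_zero_iff.1 hb
      rw [norm_sub_rev, he, norm_zero, mul_zero] at hlt
      exact absurd hlt (not_lt.2 (mul_nonneg hl.le (norm_nonneg _)))
  · have hτs : τ < s := by
      refine lt_of_le_of_ne hs.1 fun heq => hps ?_
      rw [← heq, sub_self, norm_zero, mul_zero, sub_zero] at hs0
      rw [← heq]
      exact norm_eq_zero.1 ((mul_eq_zero.1 hs0).resolve_left hl.ne')
    have hmem : s ∈ triggerSet B K P Q θ (predictor A B φ x u) τ := by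
      refine ⟨hτs, ?_, ?_⟩
      · rwa [predictor_eq hφ h.plant (hτ.trans hs.1)]
      · rw [predictor_eq hφ h.plant (hτ.trans hs.1), predictor_eq hφ h.plant hτ]
        linarith
    have hle := (h.events.succ k τ hk).2 (mem_insert_of_mem _ ⟨s, hmem, rfl⟩)
    exact (hle.trans (WithTop.coe_le_coe.2 hs.2)).not_gt ht

/-- The held input is controlled by the current prediction `p t = x (σ t)`. -/
theorem IsClosedLoop.norm_input_le (h : IsClosedLoop A B K P Q θ φ x u T)
    (hφ : AdmissibleDelay φ) (hn : n ≠ 0) (hP : P.PosDef) (hQ : Q.PosDef) (hB : B ≠ 0)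
    (hθ₀ : 0 < θ) {t : ℝ} (ht : 0 ≤ t) :
    ‖u t‖ ≤ (inducedNorm K + lambdaMin Q * √θ / (4 * inducedNorm (P * B))) *
      ‖x (advance φ t)‖ := by
  obtain ⟨k, τ, hk, hτt, htk⟩ := h.exists_event_le hφ hn hQ hθ₀ ht
  have htr := h.trigger_le hφ hn hQ hθ₀ hk hτt htk
  have hPB := inducedNorm_pos (mul_ne_zero_of_posDef hP hB)
  rw [h.control k τ hk t hτt htk, predictor_eq hφ h.plant (h.events.nonneg hk)]
  have h1 : act K (x (advance φ τ)) = act K (x (advance φ t)) +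
      act K (x (advance φ τ) - x (advance φ t)) := by
    rw [act_sub]; abel
  rw [h1, add_mul]
  refine (norm_add_le _ _).trans (add_le_add (norm_act_le _ _) ((norm_act_le _ _).trans ?_))
  rw [div_mul_eq_mul_div, le_div_iff₀ (by positivity)]
  linarith

/-- The weighted Lyapunov function never exceeds its value at `σ 0`, the time from which on the
feedback acts on the plant. -/
theorem IsClosedLoop.lyapunov_decay (h : IsClosedLoop A B K P Q θ φ x u T)
    (hφ : AdmissibleDelay φ) (hn : n ≠ 0) (hP : P.PosDef) (hQ : Q.PosDef)
    (hLyap : (A + B * K).transpose * P + P * (A + B * K) = -Q)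
    (hθ₀ : 0 < θ) (hθ₁ : θ < 1) {t : ℝ} (ht : 0 ≤ t) :
    ⟪x (advance φ t), act P (x (advance φ t))⟫ *
        Real.exp ((2 - θ) * lambdaMin Q / (4 * lambdaMax P) * advance φ t) ≤
      ⟪x (advance φ 0), act P (x (advance φ 0))⟫ *
        Real.exp ((2 - θ) * lambdaMin Q / (4 * lambdaMax P) * advance φ 0) := by
  set W : ℝ → ℝ := fun r => ⟪x r, act P (x r)⟫ *
    Real.exp ((2 - θ) * lambdaMin Q / (4 * lambdaMax P) * r) with hW
  have hstep : ∀ (k : ℕ) (τ t : ℝ), T k = τ → τ ≤ t → (t : WithTop ℝ) ≤ T (k + 1) →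
      W (advance φ t) ≤ W (advance φ τ) := by
    intro k τ t hk hτt htk
    have hτ := h.events.nonneg hk
    have hτ' : φ 0 ≤ τ := hφ.zero_lt.le.trans hτ
    have hle := hφ.advance_le hτ' hτt
    obtain ⟨y, hxy, hy⟩ := h.exists_hasDerivAt hφ hk hτt htk
    have hanti := EventTrigger.lyapunov_decay hP hQ hθ₀ hθ₁ hn hLyap hy fun r hr => by
      have hr0 : 0 ≤ r := (hφ.advance_nonneg hτ').trans hr.1
      have h1 : τ ≤ φ r := by
        have := hφ.strictMonoOn.monotoneOn (hφ.advance_nonneg hτ') hr0 hr.1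
        rwa [hφ.apply_advance hτ'] at this
      have h2 : φ r < t := by
        have := hφ.strictMonoOn hr0 (hr0.trans hr.2.le) hr.2
        rwa [hφ.apply_advance (hτ'.trans hτt)] at this
      have := h.trigger_le hφ hn hQ hθ₀ hk h1 (lt_of_lt_of_le (WithTop.coe_lt_coe.2 h2) htk)
      rw [hφ.advance_apply hr0] at this
      rwa [← hxy _ (left_mem_Icc.2 hle), ← hxy _ (Ico_subset_Icc_self hr)]
    have := hanti (left_mem_Icc.2 hle) (right_mem_Icc.2 hle) hle
    simp only [← hxy _ (left_mem_Icc.2 hle), ← hxy _ (right_mem_Icc.2 hle)] at this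
    exact this
  have hevent : ∀ (k : ℕ) (τ : ℝ), T k = τ → W (advance φ τ) ≤ W (advance φ 0) := by
    intro k
    induction k with
    | zero =>
      intro τ hτ
      rw [h.events.zero] at hτ
      rw [← WithTop.coe_injective hτ]
    | succ k ih =>
      intro τ' hτ'
      obtain ⟨τ, hτ, hlt, _⟩ := h.events.of_succ hτ'
      exact (hstep k τ τ' hτ hlt.le hτ'.ge).trans (ih τ hτ)
  obtain ⟨k, τ, hk, hτt, htk⟩ := h.exists_event_le hφ hn hQ hθ₀ ht
  exact (hstep k τ t hk hτt htk.le).trans (hevent k τ hk)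

theorem IsClosedLoop.intervalIntegrable_of_nonneg (h : IsClosedLoop A B K P Q θ φ x u T)
    (hφ : AdmissibleDelay φ) (hn : n ≠ 0) (hQ : Q.PosDef) (hθ₀ : 0 < θ) {t : ℝ} (ht : 0 ≤ t) :
    IntervalIntegrable (fun τ => ‖u τ‖ ^ 2) volume 0 t := by
  have hstep : ∀ (k : ℕ) (τ t : ℝ), T k = τ → τ ≤ t → (t : WithTop ℝ) ≤ T (k + 1) →
      IntervalIntegrable (fun τ => ‖u τ‖ ^ 2) volume τ t := by
    intro k τ t hk hτt htk
    refine (intervalIntegrable_const (c := ‖act K (predictor A B φ x u τ)‖ ^ 2)).congr_ae ?_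
    -- The input is constant on `[τ, t)`, and the end point is a null set.
    rw [uIoc_of_le hτt, ← restrict_Ico_eq_restrict_Ioc]
    refine (ae_restrict_mem measurableSet_Ico).mono fun s hs => ?_
    simp only [h.control k τ hk s hs.1 (lt_of_lt_of_le (WithTop.coe_lt_coe.2 hs.2) htk)]
  have hevent : ∀ (k : ℕ) (τ : ℝ), T k = τ →
      IntervalIntegrable (fun τ => ‖u τ‖ ^ 2) volume 0 τ := by
    intro k
    induction k with
    | zero =>
      intro τ hτ
      rw [h.events.zero] at hτ
      rw [← WithTop.coe_injective hτ]
    | succ k ih =>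
      intro τ' hτ'
      obtain ⟨τ, hτ, hlt, _⟩ := h.events.of_succ hτ'
      exact (ih τ hτ).trans (hstep k τ τ' hτ hlt.le hτ'.ge)
  obtain ⟨k, τ, hk, hτt, htk⟩ := h.exists_event_le hφ hn hQ hθ₀ ht
  exact (hevent k τ hk).trans (hstep k τ t hk hτt htk.le)

end ClosedLoop

/-! ### Exponential estimates -/

section Estimate

open scoped RealInnerProductSpace

/-- Cauchy–Schwarz against the constant function `1`, by integrating `(‖f‖ - mean) ^ 2 ≥ 0`. -/
theorem sq_integral_norm_le {F : Type*} [NormedAddCommGroup F] {f : ℝ → F} {a b : ℝ} (hab : a < b)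
    (hf : IntervalIntegrable (fun s => ‖f s‖) volume a b)
    (hf2 : IntervalIntegrable (fun s => ‖f s‖ ^ 2) volume a b) :
    (∫ s in a..b, ‖f s‖) ^ 2 ≤ (b - a) * ∫ s in a..b, ‖f s‖ ^ 2 := by
  have hba : 0 < b - a := sub_pos.2 hab
  set J := ∫ s in a..b, ‖f s‖
  have h1 : 0 ≤ ∫ s in a..b, (‖f s‖ - J / (b - a)) ^ 2 :=
    intervalIntegral.integral_nonneg hab.le fun _ _ => sq_nonneg _
  have h2 : ∫ s in a..b, (‖f s‖ - J / (b - a)) ^ 2 =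
      (∫ s in a..b, ‖f s‖ ^ 2) - 2 * (J / (b - a)) * J + (b - a) * (J / (b - a)) ^ 2 := by
    have h3 : ∀ s, (‖f s‖ - J / (b - a)) ^ 2 =
        ‖f s‖ ^ 2 - 2 * (J / (b - a)) * ‖f s‖ + (J / (b - a)) ^ 2 := fun s => by ring
    simp only [h3]
    rw [intervalIntegral.integral_add (hf2.sub (hf.const_mul _)) intervalIntegrable_const,
      intervalIntegral.integral_sub hf2 (hf.const_mul _), intervalIntegral.integral_const_mul,
      intervalIntegral.integral_const, smul_eq_mul]
  rw [h2] at h1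
  have h4 : (∫ s in a..b, ‖f s‖ ^ 2) - 2 * (J / (b - a)) * J + (b - a) * (J / (b - a)) ^ 2 =
      (∫ s in a..b, ‖f s‖ ^ 2) - J ^ 2 / (b - a) := by
    field_simp; ring
  rw [h4, sub_nonneg, div_le_iff₀ hba] at h1
  linarith

variable {n m : ℕ} {A : Matrix (Fin n) (Fin n) ℝ} {B : Matrix (Fin n) (Fin m) ℝ}
  {K : Matrix (Fin m) (Fin n) ℝ} {P Q : Matrix (Fin n) (Fin n) ℝ} {θ : ℝ} {φ : ℝ → ℝ}
  {x : ℝ → Vec n} {u : ℝ → Vec m} {T : ℕ → WithTop ℝ}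

theorem IsClosedLoop.initial_integrable (h : IsClosedLoop A B K P Q θ φ x u T)
    (hφ : AdmissibleDelay φ) :
    IntervalIntegrable (fun s => ‖u s‖) volume (φ 0) 0 ∧
      IntervalIntegrable (fun s => ‖u s‖ ^ 2) volume (φ 0) 0 := by
  obtain ⟨M, hM⟩ := h.init_bdd
  have hb : ∀ᵐ s ∂volume.restrict (Ico (φ 0) 0), ‖u s‖ ≤ M :=
    (ae_restrict_mem measurableSet_Ico).mono hM
  simp only [intervalIntegrable_iff, uIoc_of_le hφ.zero_lt.le, IntegrableOn,
    ← restrict_Ico_eq_restrict_Ioc]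
  have : IsFiniteMeasure (volume.restrict (Ico (φ 0) 0)) := ⟨by simp⟩
  constructor
  · exact Integrable.of_bound h.init_meas.norm M (hb.mono fun s hs => by simpa using hs)
  · refine Integrable.of_bound (h.init_meas.norm.pow 2) (M ^ 2) (hb.mono fun s hs => ?_)
    simpa using pow_le_pow_left₀ (norm_nonneg _) hs 2

/-- On `[0, σ 0]` only the initial input reaches the plant, and the state is bounded by the initial data. -/
theorem exists_initial_bound (A : Matrix (Fin n) (Fin n) ℝ) (B : Matrix (Fin n) (Fin m) ℝ)
    (K : Matrix (Fin m) (Fin n) ℝ) (P Q : Matrix (Fin n) (Fin n) ℝ) (θ : ℝ)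
    (hφ : AdmissibleDelay φ) :
    ∃ C : ℝ, 0 < C ∧ ∀ (x : ℝ → Vec n) (u : ℝ → Vec m) (T : ℕ → WithTop ℝ),
      IsClosedLoop A B K P Q θ φ x u T → ∀ t ∈ Icc 0 (advance φ 0),
        ‖x t‖ ^ 2 ≤ C * (‖x 0‖ ^ 2 + ∫ τ in (φ 0)..0, ‖u τ‖ ^ 2) := by
  have h0 := hφ.zero_lt
  obtain ⟨M, hM⟩ : ∃ M, ∀ c ∈ Icc 0 (advance φ 0),
      ‖NormedSpace.exp (c • Matrix.toEuclideanCLM (n := Fin n) (𝕜 := ℝ) A)‖ ≤ M :=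
    isCompact_Icc.exists_bound_of_continuousOn (continuous_iff_continuousAt.2 fun c =>
      (hasDerivAt_exp_smul_const (𝕂 := ℝ) (Matrix.toEuclideanCLM (n := Fin n) (𝕜 := ℝ) A)
        c).continuousAt).continuousOn
  obtain ⟨D, hD, hσ'⟩ := hφ.exists_derivWithin_advance_le
  have hσ0 := hφ.advance_nonneg h0.le
  have hM0 : 0 ≤ M := (norm_nonneg _).trans (hM 0 ⟨le_rfl, hσ0⟩)
  have hE : ∀ c ∈ Icc 0 (advance φ 0), ∀ v : Vec n,
      ‖act (NormedSpace.exp (c • A)) v‖ ≤ M * ‖v‖ := fun c hc v => by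
    rw [act_exp_smul]
    exact ContinuousLinearMap.le_of_opNorm_le _ (hM c hc) v
  have hBn := inducedNorm_nonneg B
  set N := D * (M * inducedNorm B) with hN
  have hN0 : 0 ≤ N := by positivity
  refine ⟨2 * M ^ 2 + 2 * N ^ 2 * (0 - φ 0) + 1, by nlinarith [sq_nonneg M, sq_nonneg N], ?_⟩
  intro x u T h t ht
  obtain ⟨hu1, hu2⟩ := h.initial_integrable hφ
  have hφt : φ 0 ≤ φ t := hφ.strictMonoOn.monotoneOn (mem_Ici.2 le_rfl) ht.1 ht.1
  have hφt0 : φ t ≤ 0 := by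
    have := hφ.strictMonoOn.monotoneOn ht.1 hσ0 ht.2
    rwa [hφ.apply_advance h0.le] at this
  have hint : ‖∫ r in (0 : ℝ)..t, act (NormedSpace.exp ((t - r) • A)) (act B (u (φ r)))‖ ≤
      N * ∫ q in (φ 0)..0, ‖u q‖ := by
    -- After the substitution only the norm of the input itself has to be integrable.
    rw [hφ.integral_substitution le_rfl ht.1]
    have hsub : IntervalIntegrable (fun s => ‖u s‖) volume (φ 0) (φ t) :=
      hu1.mono_set (by
        rw [uIcc_of_le hφt, uIcc_of_le h0.le]; exact Icc_subset_Icc_right hφt0)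
    have hle1 : ‖∫ q in (φ 0)..(φ t), derivWithin (advance φ) (Ici (φ 0)) q •
        act (NormedSpace.exp ((t - advance φ q) • A)) (act B (u (φ (advance φ q))))‖ ≤
        ∫ q in (φ 0)..(φ t), N * ‖u q‖ := by
      refine intervalIntegral.norm_integral_le_of_norm_le hφt
        (Filter.Eventually.of_forall fun q hq => ?_) (hsub.const_mul _)
      have hq1 := hφ.advance_le hq.1.le hq.2
      rw [hφ.advance_apply ht.1] at hq1
      rw [norm_smul, Real.norm_of_nonneg (hφ.derivWithin_advance_nonneg hq.1),
        hφ.apply_advance hq.1.le, hN, mul_assoc]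
      refine mul_le_mul (hσ' q hq.1) ?_ (norm_nonneg _) hD.le
      rw [mul_assoc]
      refine (hE _ ⟨sub_nonneg.2 hq1, ?_⟩ _).trans
        (mul_le_mul_of_nonneg_left (norm_act_le _ _) hM0)
      linarith [ht.2, hφ.advance_nonneg hq.1.le]
    refine hle1.trans ?_
    rw [intervalIntegral.integral_const_mul]
    refine mul_le_mul_of_nonneg_left ?_ hN0
    exact intervalIntegral.integral_mono_interval le_rfl hφt hφt0
      (Filter.Eventually.of_forall fun _ => norm_nonneg _) hu1
  have hx : ‖x t‖ ≤ M * ‖x 0‖ + N * ∫ q in (φ 0)..0, ‖u q‖ := by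
    rw [(h.plant.variation_of_constants le_rfl ht.1).2]
    exact (norm_add_le _ _).trans (add_le_add (hE _ (by rwa [sub_zero]) _) hint)
  have hcs := sq_integral_norm_le h0 hu1 hu2
  set J := ∫ q in (φ 0)..0, ‖u q‖
  set S := ∫ q in (φ 0)..0, ‖u q‖ ^ 2
  have hS : 0 ≤ S := intervalIntegral.integral_nonneg h0.le fun _ _ => sq_nonneg _
  have hx2 : ‖x t‖ ^ 2 ≤ 2 * M ^ 2 * ‖x 0‖ ^ 2 + 2 * N ^ 2 * J ^ 2 := by
    have h1 := pow_le_pow_left₀ (norm_nonneg _) hx 2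
    nlinarith [sq_nonneg (M * ‖x 0‖ - N * J)]
  have h2 : 2 * N ^ 2 * J ^ 2 ≤ 2 * N ^ 2 * ((0 - φ 0) * S) :=
    mul_le_mul_of_nonneg_left hcs (by positivity)
  have h3 : 0 ≤ 2 * N ^ 2 * (0 - φ 0) * ‖x 0‖ ^ 2 := by
    have : 0 ≤ 0 - φ 0 := by linarith
    positivity
  have h4 : 0 ≤ 2 * M ^ 2 * S := by positivity
  nlinarith [sq_nonneg ‖x 0‖]

/-- Exponential decay of the state, uniformly over all closed-loop trajectories. -/
theorem exists_state_bound (hn : n ≠ 0) (hP : P.PosDef) (hQ : Q.PosDef)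
    (hLyap : (A + B * K).transpose * P + P * (A + B * K) = -Q)
    (hθ₀ : 0 < θ) (hθ₁ : θ < 1) (hφ : AdmissibleDelay φ) :
    ∃ C : ℝ, 0 < C ∧ ∀ (x : ℝ → Vec n) (u : ℝ → Vec m) (T : ℕ → WithTop ℝ),
      IsClosedLoop A B K P Q θ φ x u T → ∀ t : ℝ, 0 ≤ t →
        ‖x t‖ ^ 2 ≤ C * Real.exp (-((2 - θ) * lambdaMin Q / (4 * lambdaMax P)) * t) *
          (‖x 0‖ ^ 2 + ∫ τ in (φ 0)..0, ‖u τ‖ ^ 2) := by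
  have : NeZero n := ⟨hn⟩
  obtain ⟨C, hC, hbound⟩ := exists_initial_bound A B K P Q θ hφ
  have hp := lambdaMin_pos hP
  have hP' := lambdaMax_pos hP
  have hq := lambdaMin_pos hQ
  have h0 := hφ.zero_lt
  have hσ0 := hφ.advance_nonneg h0.le
  have hθ2 : 0 < 2 - θ := by linarith
  have hμ : 0 < (2 - θ) * lambdaMin Q / (4 * lambdaMax P) := by positivity
  set μ := (2 - θ) * lambdaMin Q / (4 * lambdaMax P) with hμdef
  set σ₀ := advance φ 0 with hσ₀
  refine ⟨(1 + lambdaMax P / lambdaMin P) * C * Real.exp (μ * σ₀), by positivity, ?_⟩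
  intro x u T h t ht
  set S := ‖x 0‖ ^ 2 + ∫ τ in (φ 0)..0, ‖u τ‖ ^ 2
  have hS : 0 ≤ S := add_nonneg (sq_nonneg _)
    (intervalIntegral.integral_nonneg h0.le fun _ _ => sq_nonneg _)
  have hexp : Real.exp (μ * σ₀) * Real.exp (-μ * t) = Real.exp (μ * (σ₀ - t)) := by
    rw [← Real.exp_add]; ring_nf
  have hgoal : (1 + lambdaMax P / lambdaMin P) * C * Real.exp (μ * σ₀) * Real.exp (-μ * t) * S =
      (1 + lambdaMax P / lambdaMin P) * (C * S) * Real.exp (μ * (σ₀ - t)) := by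
    rw [← hexp]; ring
  rw [hgoal]
  have hr : 0 < lambdaMax P / lambdaMin P := by positivity
  have hCS : 0 ≤ C * S := by positivity
  rcases le_total t σ₀ with hts | hts
  · have h1 : 1 ≤ Real.exp (μ * (σ₀ - t)) :=
      Real.one_le_exp (mul_nonneg hμ.le (sub_nonneg.2 hts))
    calc ‖x t‖ ^ 2 ≤ C * S := hbound x u T h t ⟨ht, hts⟩
      _ ≤ (1 + lambdaMax P / lambdaMin P) * (C * S) := by nlinarith
      _ ≤ _ := le_mul_of_one_le_right (by positivity) h1
  · have hφt : 0 ≤ φ t := by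
      have := hφ.strictMonoOn.monotoneOn hσ0 ht hts
      rwa [hσ₀, hφ.apply_advance h0.le] at this
    have hdec := h.lyapunov_decay hφ hn hP hQ hLyap hθ₀ hθ₁ hφt
    rw [hφ.advance_apply ht] at hdec
    have h1 := lambdaMin_mul_norm_sq_le hP.1 (x t)
    have h2 := inner_act_le_lambdaMax_mul hP.1 (x σ₀)
    have h3 := hbound x u T h σ₀ ⟨hσ0, le_rfl⟩
    have h4 : lambdaMin P * ‖x t‖ ^ 2 ≤ lambdaMax P * (C * S) * Real.exp (μ * (σ₀ - t)) := by
      have h5 : ⟪x t, act P (x t)⟫ ≤ ⟪x σ₀, act P (x σ₀)⟫ * Real.exp (μ * (σ₀ - t)) := by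
        have h6 : Real.exp (μ * (σ₀ - t)) = Real.exp (μ * σ₀) / Real.exp (μ * t) := by
          rw [← Real.exp_sub]; ring_nf
        rw [h6, ← mul_div_assoc, le_div_iff₀ (Real.exp_pos _)]
        exact hdec
      refine h1.trans (h5.trans (mul_le_mul_of_nonneg_right ?_ (Real.exp_pos _).le))
      exact h2.trans (mul_le_mul_of_nonneg_left h3 hP'.le)
    have h7 : ‖x t‖ ^ 2 ≤ lambdaMax P / lambdaMin P * (C * S) * Real.exp (μ * (σ₀ - t)) := by
      rw [div_mul_eq_mul_div, div_mul_eq_mul_div, le_div_iff₀ hp]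
      linarith
    refine h7.trans (mul_le_mul_of_nonneg_right ?_ (Real.exp_pos _).le)
    exact mul_le_mul_of_nonneg_right (by linarith) hCS

end Estimate

end EventTrigger

theorem theorem3 {n m : ℕ}
    (A : Matrix (Fin n) (Fin n) ℝ) (B : Matrix (Fin n) (Fin m) ℝ)
    (K : Matrix (Fin m) (Fin n) ℝ) (P Q : Matrix (Fin n) (Fin n) ℝ)
    (hB : B ≠ 0) (hP : P.PosDef) (hQ : Q.PosDef)
    (hLyap : (A + B * K).transpose * P + P * (A + B * K) = -Q)
    (θ : ℝ) (hθ₀ : 0 < θ) (hθ₁ : θ < 1)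
    (φ : ℝ → ℝ) (hφ : EventTrigger.AdmissibleDelay φ) :
    ∃ C : ℝ, 0 < C ∧
      ∀ (x : ℝ → EventTrigger.Vec n) (u : ℝ → EventTrigger.Vec m) (T : ℕ → WithTop ℝ),
        EventTrigger.IsClosedLoop A B K P Q θ φ x u T →
        ∀ t : ℝ, 0 ≤ t →
          IntervalIntegrable (fun τ => ‖u τ‖ ^ 2) volume (φ t) t ∧
          ‖x t‖ ^ 2 + (∫ τ in (φ t)..t, ‖u τ‖ ^ 2) ≤
            C * Real.exp
                (-((2 - θ) * EventTrigger.lambdaMin Q / (4 * EventTrigger.lambdaMax P)) * t) *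
              (‖x 0‖ ^ 2 + (∫ τ in (φ 0)..0, ‖u τ‖ ^ 2)) := by
  have hn : n ≠ 0 := by
    rintro rfl
    exact hB (Subsingleton.elim _ _)
  have : NeZero n := ⟨hn⟩
  obtain ⟨C, hC, hstate⟩ := EventTrigger.exists_state_bound hn hP hQ hLyap hθ₀ hθ₁ hφ
  obtain ⟨M₀, hM₀, hdelay⟩ := hφ.delay_bdd
  have hP' := EventTrigger.lambdaMax_pos hP
  have hq := EventTrigger.lambdaMin_pos hQ
  have h0 := hφ.zero_lt
  have hθ2 : 0 < 2 - θ := by linarith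
  have hμ : 0 < (2 - θ) * EventTrigger.lambdaMin Q / (4 * EventTrigger.lambdaMax P) := by
    positivity
  set μ := (2 - θ) * EventTrigger.lambdaMin Q / (4 * EventTrigger.lambdaMax P) with hμdef
  set D := EventTrigger.inducedNorm K +
    EventTrigger.lambdaMin Q * √θ / (4 * EventTrigger.inducedNorm (P * B)) with hD
  refine ⟨C + D ^ 2 * C * M₀ + Real.exp (μ * M₀), by positivity, ?_⟩
  intro x u T h t ht
  have hui := (h.initial_integrable hφ).2
  have hφ0t : φ 0 ≤ φ t := hφ.strictMonoOn.monotoneOn (mem_Ici.2 le_rfl) ht ht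
  have hφt := hφ.delay_pos t ht
  have hui' : IntervalIntegrable (fun τ => ‖u τ‖ ^ 2) volume (φ 0) t :=
    hui.trans (h.intervalIntegrable_of_nonneg hφ hn hQ hθ₀ ht)
  have hut : IntervalIntegrable (fun τ => ‖u τ‖ ^ 2) volume (φ t) t := by
    refine hui'.mono_set ?_
    rw [uIcc_of_le (by linarith), uIcc_of_le (by linarith)]
    exact Icc_subset_Icc_left hφ0t
  refine ⟨hut, ?_⟩
  have hx := hstate x u T h t ht
  set S := ‖x 0‖ ^ 2 + ∫ τ in (φ 0)..0, ‖u τ‖ ^ 2 with hSdef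
  have hS : 0 ≤ S := add_nonneg (sq_nonneg _)
    (intervalIntegral.integral_nonneg h0.le fun _ _ => sq_nonneg _)
  -- The feedback part of the input energy: for `τ ≥ φ t` the prediction at `τ` is a state at a time
  -- `σ τ ≥ t`, and the interval has length at most `M₀`.
  have hfeed : ∀ a : ℝ, 0 ≤ a → φ t ≤ a → a ≤ t → ∫ τ in a..t, ‖u τ‖ ^ 2 ≤
      D ^ 2 * C * M₀ * Real.exp (-μ * t) * S := by
    intro a ha hat hat'
    have hpt : ∀ τ ∈ Icc a t, ‖u τ‖ ^ 2 ≤ D ^ 2 * (C * Real.exp (-μ * t) * S) := by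
      intro τ hτ
      have hτ0 := ha.trans hτ.1
      have h1 := h.norm_input_le hφ hn hP hQ hB hθ₀ hτ0
      have h2 : t ≤ EventTrigger.advance φ τ := by
        have := hφ.advance_le hφ0t (hat.trans hτ.1)
        rwa [hφ.advance_apply ht] at this
      have h3 := hstate x u T h _ (ht.trans h2)
      have h4 : Real.exp (-μ * EventTrigger.advance φ τ) ≤ Real.exp (-μ * t) :=
        Real.exp_le_exp.2 (by nlinarith)
      have h5 := pow_le_pow_left₀ (norm_nonneg _) h1 2
      rw [mul_pow] at h5
      refine h5.trans (mul_le_mul_of_nonneg_left (h3.trans ?_) (sq_nonneg _))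
      exact mul_le_mul_of_nonneg_right (mul_le_mul_of_nonneg_left h4 hC.le) hS
    have hai : IntervalIntegrable (fun τ => ‖u τ‖ ^ 2) volume a t := by
      refine hut.mono_set ?_
      rw [uIcc_of_le hat', uIcc_of_le (by linarith)]
      exact Icc_subset_Icc_left hat
    refine (intervalIntegral.integral_mono_on hat' hai intervalIntegrable_const hpt).trans ?_
    rw [intervalIntegral.integral_const, smul_eq_mul]
    have h6 : t - a ≤ M₀ := by linarith [hdelay t ht]
    have h7 : 0 ≤ D ^ 2 * (C * Real.exp (-μ * t) * S) := by positivity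
    nlinarith [mul_le_mul_of_nonneg_right h6 h7]
  have hE : 0 < Real.exp (-μ * t) := Real.exp_pos _
  rcases le_total 0 (φ t) with hpos | hneg
  · have h1 := hfeed (φ t) hpos le_rfl (by linarith)
    have h2 : 0 ≤ Real.exp (μ * M₀) * Real.exp (-μ * t) * S := by positivity
    nlinarith
  · have h1 := hfeed 0 le_rfl hneg ht
    have hsplit : ∫ τ in (φ t)..t, ‖u τ‖ ^ 2 =
        (∫ τ in (φ t)..0, ‖u τ‖ ^ 2) + ∫ τ in (0 : ℝ)..t, ‖u τ‖ ^ 2 := by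
      refine (intervalIntegral.integral_add_adjacent_intervals (hui.mono_set ?_)
        (h.intervalIntegrable_of_nonneg hφ hn hQ hθ₀ ht)).symm
      rw [uIcc_of_le hneg, uIcc_of_le h0.le]
      exact Icc_subset_Icc_left hφ0t
    have h2 : ∫ τ in (φ t)..0, ‖u τ‖ ^ 2 ≤ S := by
      refine (intervalIntegral.integral_mono_interval hφ0t hneg le_rfl
        (Filter.Eventually.of_forall fun _ => sq_nonneg _) hui).trans ?_
      exact le_add_of_nonneg_left (sq_nonneg _)
    -- Initial input is present in `[φ t, t]` only if `φ t ≤ 0`, that is, only for `t ≤ M₀`.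
    have h3 : S ≤ Real.exp (μ * M₀) * Real.exp (-μ * t) * S := by
      refine le_mul_of_one_le_left hS ?_
      rw [← Real.exp_add]
      exact Real.one_le_exp (by nlinarith [hdelay t ht])
    rw [hsplit]
    nlinarith
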